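/- Let $\Omega$ be a (nonempty) complete separable metric space and let $\nu(d\beta\,d\omega)$ be a Borel measure on $\mathbb{R}\times\Omega$ with $\nu(\{0\}\times\Omega)=0$. Let $\{K_\varepsilon\}_{\varepsilon>0}$ be compact sets that increase to $\Omega$ as $\varepsilon\to0$, let $\nu_\varepsilon$ be the restriction of $\nu$ to $[-\varepsilon,\varepsilon]^c\times K_\varepsilon$, and put $\nu_\varepsilon^+=\nu_\varepsilon(\mathbb{R}\times\Omega)$. Suppose that either (a) $\iint_{\mathbb{R}\times K}(1\wedge|\beta|)\,\nu(d\beta\,d\omega)<\infty$ for every compact $K\subset\Omega$, and $h\equiv0$ (no compensation); or (b) $\iint_{\mathbb{R}\times K}(1\wedge\beta^2)\,\nu(d\beta\,d\omega)<\infty$ for every compact $K\subset\Omega$, $\nu$ is invariant under $(\beta,\omega)\mapsto(-\beta,\omega)$, and the compensator $h:\mathbb{R}\to\mathbb{R}$ is a bounded measurable odd function with $h(\beta)=\beta+O(\beta^2)$ as $\beta\to0$. Let $\mathcal N$ be a Poisson random measure on $\mathbb{R}\times\Omega$ with intensity $\nu$, and let $\tilde{\mathcal N}=\mathcal N-\nu$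 be the compensated measure, whose integral is defined by extending the isometry $F\mapsto\int F\,d\mathcal N-\int F\,d\nu$ from $L_1(\nu)\cap L_2(\nu)$ to $L_2(\nu)$, and by $\int F\,d\mathcal N-\int F\,d\nu$ on $L_1(\nu)$. Let $g:\mathcal X\times\Omega\to\mathbb{R}$ be such that, for each $x\in\mathcal X$, $\phi=g(x,\cdot)$ is measurable with $$\iint\bigl(1\wedge|(\beta-h(\beta))\phi(\omega)|\bigr)\,\nu(d\beta\,d\omega)<\infty,\qquad \iint\bigl(|h(\beta)\phi(\omega)|\wedge|h(\beta)\phi(\omega)|^2\bigr)\,\nu(d\beta\,d\omega)<\infty,$$ and set $$f(x)=\iint g(x,\omega)\,[\beta-h(\beta)]\,\mathcal N(d\beta\,d\omega)+\iint g(x,\omega)\,h(\beta)\,\tilde{\mathcal N}(d\beta\,d\omega),$$ which in case (a) is $\iint g(x,\omega)\,\beta\,\mathcal N(d\beta\,d\omega)$. Then $\nu_\varepsilon^+<\infty$ for every $\varepsilon>0$ and, after the probability space has been enlarged by an independent uniform random variable, the points of $\mathcal N$ in $[-\varepsilon,\varepsilon]^c\times K_\varepsilon$ can, for every $\varepsilon>0$,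 be listed almost surely (with multiplicity) as $(\beta_j,\omega_j)_{0\le j<J_\varepsilon}$ (the list depends on $\varepsilon$), with $$J_\varepsilon\sim\mathrm{Po}(\nu_\varepsilon^+),\qquad (\beta_j,\omega_j)_{0\le j<J_\varepsilon}\mid J_\varepsilon\ \overset{\text{i.i.d.}}{\sim}\ \nu_\varepsilon(d\beta\,d\omega)/\nu_\varepsilon^+ .$$ For any such listing and each $x\in\mathcal X$, the finite random sum $$f_\varepsilon(x)=\sum_{0\le j<J_\varepsilon}g(x,\omega_j)\,\beta_j$$ converges to $f(x)$ in probability as $\varepsilon\to0$. -/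

import Mathlib

open MeasureTheory ProbabilityTheory Set Filter Topology Asymptotics
open scoped ENNReal NNReal

noncomputable section

namespace LevyField

/-- The Poisson law with mean `r ∈ [0, ∞]`, as a law on `[0, ∞]`; it is the point mass at `∞`
when `r = ∞`. -/
def poissonLaw (r : ℝ≥0∞) : Measure ℝ≥0∞ :=
  if r = ∞ then Measure.dirac ∞ else (poissonMeasure r.toNNReal).map (fun n : ℕ => (n : ℝ≥0∞))

/-- `N` is a Poisson random measure on `S` with intensity `ν`, on the space `(Θ, P)`. -/
structure IsPoissonRandomMeasure {Θ S : Type*} [MeasurableSpace Θ] [MeasurableSpace S]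
    (P : Measure Θ) (ν : Measure S) (N : Θ → Measure S) : Prop where
  measurable : Measurable N
  law : ∀ C : Set S, MeasurableSet C → P.map (fun θ => N θ C) = poissonLaw (ν C)
  indep : ∀ (n : ℕ) (C : Fin n → Set S), (∀ i, MeasurableSet (C i)) →
    Pairwise (fun i j => Disjoint (C i) (C j)) → iIndepFun (fun i θ => N θ (C i)) P

/-- The centered integral `∫ F dN - ∫ F dν`, for `F ∈ L¹(ν)`. -/
def centeredIntegral {Θ S : Type*} [MeasurableSpace S]
    (ν : Measure S) (N : Θ → Measure S) (F : S → ℝ) (θ : Θ) : ℝ :=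
  (∫ s, F s ∂(N θ)) - ∫ s, F s ∂ν

/-- `Y ∈ L²(P)` is the value at `F ∈ L²(ν)` of the `L²`-continuous extension of the isometry
`G ↦ ∫ G dN - ∫ G dν`, `G ∈ L¹(ν) ∩ L²(ν)`. -/
def IsL2CompensatedIntegral {Θ S : Type*} [MeasurableSpace Θ] [MeasurableSpace S]
    (P : Measure Θ) (ν : Measure S) (N : Θ → Measure S) (F : S → ℝ) (Y : Θ → ℝ) : Prop :=
  MemLp Y 2 P ∧ ∃ G : ℕ → S → ℝ,
    (∀ n, Measurable (G n) ∧ Integrable (G n) ν ∧ MemLp (G n) 2 ν) ∧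
    Tendsto (fun n => eLpNorm (G n - F) 2 ν) atTop (𝓝 0) ∧
    Tendsto (fun n => eLpNorm (centeredIntegral ν N (G n) - Y) 2 P) atTop (𝓝 0)

open Classical in
/-- The integral `∫ F d(N - ν)` of `F ∈ L²(ν)` (a version of it; it is determined up to
`P`-null sets). -/
def l2CompensatedIntegral {Θ S : Type*} [MeasurableSpace Θ] [MeasurableSpace S]
    (P : Measure Θ) (ν : Measure S) (N : Θ → Measure S) (F : S → ℝ) : Θ → ℝ :=
  if hY : ∃ Y, IsL2CompensatedIntegral P ν N F Y then hY.choose else 0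

/-- The integral `∫ F d(N - ν)` for `∫ min(|F|, F²) dν < ∞`: the part of `F` with `|F| ≤ 1` lies
in `L²(ν)` and is integrated by the isometry, the part with `|F| > 1` lies in `L¹(ν)`. -/
def compensatedIntegral {Θ S : Type*} [MeasurableSpace Θ] [MeasurableSpace S]
    (P : Measure Θ) (ν : Measure S) (N : Θ → Measure S) (F : S → ℝ) (θ : Θ) : ℝ :=
  l2CompensatedIntegral P ν N ({s | |F s| ≤ 1}.indicator F) θ
    + centeredIntegral ν N ({s | 1 < |F s|}.indicator F) θ

/-- The local `L₁` integrability condition. -/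
def LocalL1 {Ω : Type*} [TopologicalSpace Ω] [MeasurableSpace Ω] (ν : Measure (ℝ × Ω)) : Prop :=
  ∀ K : Set Ω, IsCompact K → ∫⁻ p in univ ×ˢ K, min 1 ‖p.1‖ₑ ∂ν < ∞

/-- The local `L₂` integrability condition. -/
def LocalL2 {Ω : Type*} [TopologicalSpace Ω] [MeasurableSpace Ω] (ν : Measure (ℝ × Ω)) : Prop :=
  ∀ K : Set Ω, IsCompact K → ∫⁻ p in univ ×ˢ K, min 1 (‖p.1‖ₑ ^ 2) ∂ν < ∞

/-- `ν(dβ dω)` is even in `β`. -/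
def IsEven {Ω : Type*} [MeasurableSpace Ω] (ν : Measure (ℝ × Ω)) : Prop :=
  ν.map (fun p : ℝ × Ω => (-p.1, p.2)) = ν

/-- Compensator functions: bounded, measurable, with `h(β) = β + O(β²)` as `β → 0`. -/
structure IsCompensator (h : ℝ → ℝ) : Prop where
  measurable : Measurable h
  bounded : ∃ c : ℝ, ∀ b, |h b| ≤ c
  near_zero : (fun b : ℝ => h b - b) =O[𝓝 0] fun b : ℝ => b ^ 2

/-- The measurable functions `φ` for which both integrals in the definition of `levyIntegral`
converge. -/
structure IsIntegrand {Ω : Type*} [MeasurableSpace Ω] (ν : Measure (ℝ × Ω)) (h : ℝ → ℝ)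
    (φ : Ω → ℝ) : Prop where
  measurable : Measurable φ
  poisson : ∫⁻ p, min 1 ‖(p.1 - h p.1) * φ p.2‖ₑ ∂ν < ∞
  compensated : ∫⁻ p, min ‖h p.1 * φ p.2‖ₑ (‖h p.1 * φ p.2‖ₑ ^ 2) ∂ν < ∞

/-- The random variable
`ℒ[φ] = ∬ (β - h(β)) φ(ω) N(dβ dω) + ∬ h(β) φ(ω) (N - ν)(dβ dω)`. For `h = 0` it is the
uncompensated integral `∬ β φ(ω) N(dβ dω)`. -/
def levyIntegral {Θ Ω : Type*} [MeasurableSpace Θ] [MeasurableSpace Ω] (P : Measure Θ)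
    (ν : Measure (ℝ × Ω)) (N : Θ → Measure (ℝ × Ω)) (h : ℝ → ℝ) (φ : Ω → ℝ) (θ : Θ) : ℝ :=
  (∫ p, (p.1 - h p.1) * φ p.2 ∂(N θ))
    + compensatedIntegral P ν N (fun p => h p.1 * φ p.2) θ

/-- The set `[-ε, ε]ᶜ × K_ε`. -/
def truncSet {Ω : Type*} (K : ℝ → Set Ω) (ε : ℝ) : Set (ℝ × Ω) :=
  (Icc (-ε) ε)ᶜ ×ˢ K ε

/-- `J` has the Poisson law with mean `μ(S)` and, given `J`, the points `Z₀, …, Z_{J-1}` are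
independent with law `μ / μ(S)` (for a finite measure `μ`). -/
structure IsPoissonSample {Θ S : Type*} [MeasurableSpace Θ] [MeasurableSpace S]
    (P : Measure Θ) (μ : Measure S) (J : Θ → ℕ) (Z : ℕ → Θ → S) : Prop where
  measurable_count : Measurable J
  measurable_point : ∀ j, Measurable (Z j)
  law_count : P.map J = poissonMeasure (μ univ).toNNReal
  cond_iid : ∀ (n : ℕ) (B : Fin n → Set S), (∀ i, MeasurableSet (B i)) →
    P ({θ | J θ = n} ∩ {θ | ∀ i : Fin n, Z i θ ∈ B i})
      = P {θ | J θ = n} * ∏ i, (μ (B i) / μ univ)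

/-- For every `ε > 0`, the points of `N` in `[-ε, ε]ᶜ × K_ε` are `Z ε 0, …, Z ε (J ε - 1)`,
where `J ε` is Poisson with mean `ν_ε(ℝ × Ω)` and the points are i.i.d. with law
`ν_ε / ν_ε(ℝ × Ω)` given `J ε`; here `ν_ε` is the restriction of `ν` to `[-ε, ε]ᶜ × K_ε`. -/
structure IsTruncatedSample {Θ Ω : Type*} [MeasurableSpace Θ] [MeasurableSpace Ω]
    (P : Measure Θ) (ν : Measure (ℝ × Ω)) (N : Θ → Measure (ℝ × Ω)) (K : ℝ → Set Ω)
    (J : ℝ → Θ → ℕ) (Z : ℝ → ℕ → Θ → ℝ × Ω) : Prop where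
  sample : ∀ ε, 0 < ε → IsPoissonSample P (ν.restrict (truncSet K ε)) (J ε) (Z ε)
  points : ∀ ε, 0 < ε → ∀ᵐ θ ∂P, (N θ).restrict (truncSet K ε)
    = ∑ j ∈ Finset.range (J ε θ), Measure.dirac (Z ε j θ)

end LevyField

end

noncomputable section

namespace LevyField

/-! ### Moments of the Poisson law. -/

section PoissonMoments

open scoped Nat

/-! Convergence. Put `F = βφ(ω)`, `H = h(β)φ(ω)` and let `A` be the truncation set, which has finite
intensity. Split `H = H₁ + H₂` according to `|H| ≤ 1` or `|H| > 1`. In the even case `H` is odd in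
`β` and `A` is symmetric, so the `ν`-integrals of `H₁` over `A` and of `H₂` over the whole space
vanish; without compensation `H = 0`. Hence the plain sum over the points in `A` equals `∫_A (F - H
+ H₂) dN` plus the centered integral of `1_A H₁`. The first term converges almost surely by
dominated convergence in `N θ` (`ae_integrable_of_min`, `ae_tendsto_setIntegral`). The second
converges in `L²(P)`, because centered integration is an `L²` contraction
(`lintegral_sq_centeredIntegral_le`, `tendsto_l2CompensatedIntegral`). The two limits add up to the
Lévy integral: `tendstoInMeasure_setIntegral`.

Listing. Restricted to `A`, the random measure has finite intensity, and its characteristic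
functional agrees with that of a Poisson number of i.i.d. points. The two therefore have the same
law on the space of measures (`map_eq_map_pointMeasure`). A uniform variable then samples the list
from its conditional law given the measure (`exists_transfer`), and the sampled list almost surely
reproduces the measure (`exists_isPoissonSample`). -/

lemma hasSum_poisson_mean (r : ℝ≥0) :
    HasSum (fun n : ℕ => Real.exp (-r) * r ^ n / n ! * (n : ℝ)) r := by
  rw [← hasSum_nat_add_iff' 1]
  simp only [Finset.range_one, Finset.sum_singleton, Nat.cast_zero, mul_zero, sub_zero]
  convert! (hasSum_one_poissonMeasure r).mul_left (r : ℝ) using 1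
  · ext n
    rw [Nat.factorial_succ]
    push_cast
    field_simp
    ring
  · simp

/-- Shifting the index by one turns the series into `r` times that of the mean. -/
lemma hasSum_poisson_factorial_moment (r : ℝ≥0) :
    HasSum (fun n : ℕ => Real.exp (-r) * r ^ n / n ! * ((n : ℝ) * (n - 1))) (r ^ 2) := by
  rw [← hasSum_nat_add_iff' 1]
  have := (hasSum_poisson_mean r).mul_left (r : ℝ)
  convert! this using 1
  · ext n
    rw [Nat.factorial_succ]
    push_cast
    have : (n ! : ℝ) ≠ 0 := by positivity
    field_simp
    ring
  · simp; ring

lemma hasSum_poisson_second_moment (r : ℝ≥0) :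
    HasSum (fun n : ℕ => Real.exp (-r) * r ^ n / n ! * (n : ℝ) ^ 2) (r ^ 2 + r) := by
  convert! (hasSum_poisson_factorial_moment r).add (hasSum_poisson_mean r) using 1
  ext n; ring

lemma memLp_two_poisson (r : ℝ≥0) : MemLp (fun n : ℕ => (n : ℝ)) 2 (poissonMeasure r) := by
  rw [memLp_two_iff_integrable_sq .of_discrete, integrable_poissonMeasure_iff]
  simpa using (hasSum_poisson_second_moment r).summable

lemma integral_poisson (r : ℝ≥0) : ∫ n : ℕ, (n : ℝ) ∂poissonMeasure r = r := by
  rw [integral_poissonMeasure]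
  exact (hasSum_poisson_mean r).tsum_eq

lemma variance_poisson (r : ℝ≥0) : variance (fun n : ℕ => (n : ℝ)) (poissonMeasure r) = r := by
  rw [variance_eq_sub (memLp_two_poisson r), integral_poisson]
  simp only [Pi.pow_apply]
  rw [integral_poissonMeasure]
  have := (hasSum_poisson_second_moment r).tsum_eq
  simp only [smul_eq_mul]
  rw [this]; ring

/-- The point mass at `∞` keeps this true for `r = ∞`, so Campbell's formula needs no finiteness. -/
lemma lintegral_poissonLaw (r : ℝ≥0∞) : ∫⁻ x, x ∂poissonLaw r = r := by
  unfold poissonLaw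
  split_ifs with h
  · simp [h]
  · rw [lintegral_map (f := fun x => x) measurable_id .of_discrete]
    have := ofReal_integral_eq_lintegral_ofReal
      ((memLp_two_poisson r.toNNReal).integrable one_le_two) (Eventually.of_forall fun n => by simp)
    rw [integral_poisson] at this
    simp only [ENNReal.ofReal_natCast, ENNReal.ofReal_coe_nnreal] at this
    rw [← this, ENNReal.coe_toNNReal h]

end PoissonMoments

/-! ### Campbell's formula and the `L²` bound for centered integrals. -/

section PoissonRandomMeasure

variable {Θ S : Type*} [MeasurableSpace Θ] [MeasurableSpace S] {P : Measure Θ}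
  {ν : Measure S} {N : Θ → Measure S}

namespace IsPoissonRandomMeasure

lemma measurable_apply (hN : IsPoissonRandomMeasure P ν N) {C : Set S} (hC : MeasurableSet C) :
    Measurable fun θ => N θ C :=
  (Measure.measurable_coe hC).comp hN.measurable

/-- Campbell's formula. -/
lemma bind_eq (hN : IsPoissonRandomMeasure P ν N) : P.bind N = ν := by
  ext C hC
  rw [Measure.bind_apply hC hN.measurable.aemeasurable, ← lintegral_poissonLaw (ν C), ← hN.law C hC,
    lintegral_map (f := fun x => x) measurable_id (hN.measurable_apply hC)]

lemma lintegral_lintegral (hN : IsPoissonRandomMeasure P ν N) {f : S → ℝ≥0∞} (hf : Measurable f) :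
    ∫⁻ θ, ∫⁻ s, f s ∂(N θ) ∂P = ∫⁻ s, f s ∂ν := by
  rw [← Measure.lintegral_bind hN.measurable.aemeasurable hf.aemeasurable, hN.bind_eq]

lemma ae_lintegral_lt_top (hN : IsPoissonRandomMeasure P ν N) {f : S → ℝ≥0∞} (hf : Measurable f)
    (h : ∫⁻ s, f s ∂ν < ∞) : ∀ᵐ θ ∂P, ∫⁻ s, f s ∂(N θ) < ∞ :=
  MeasureTheory.ae_lt_top (f := fun θ => ∫⁻ s, f s ∂(N θ))
    ((Measure.measurable_lintegral hf).comp hN.measurable)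
    (by rw [hN.lintegral_lintegral hf]; exact h.ne)

lemma measurable_integral (hN : IsPoissonRandomMeasure P ν N) {f : S → ℝ} (hf : Measurable f) :
    Measurable fun θ => ∫ s, f s ∂(N θ) :=
  (hf.stronglyMeasurable.integral_kernel (κ := ⟨N, hN.measurable⟩)).measurable

lemma ae_integrable (hN : IsPoissonRandomMeasure P ν N) {f : S → ℝ} (hf : Measurable f)
    (h : Integrable f ν) : ∀ᵐ θ ∂P, Integrable f (N θ) := by
  filter_upwards [hN.ae_lintegral_lt_top hf.enorm h.2] with θ hθ
  exact ⟨hf.aestronglyMeasurable, hθ⟩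

lemma ae_lt_top (hN : IsPoissonRandomMeasure P ν N) {C : Set S} (hC : MeasurableSet C)
    (h : ν C < ∞) : ∀ᵐ θ ∂P, N θ C < ∞ := by
  have := hN.ae_lintegral_lt_top (f := C.indicator 1) (measurable_one.indicator hC)
    (by rwa [lintegral_indicator_one hC])
  simpa [lintegral_indicator_one hC] using this

lemma ae_eq_zero (hN : IsPoissonRandomMeasure P ν N) {C : Set S} (hC : MeasurableSet C)
    (h : ν C = 0) : ∀ᵐ θ ∂P, N θ C = 0 := by
  have := hN.lintegral_lintegral (f := C.indicator 1) (measurable_one.indicator hC)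
  simp only [lintegral_indicator_one hC, h] at this
  rwa [lintegral_eq_zero_iff (hN.measurable_apply hC)] at this

lemma iIndepFun_fintype (hN : IsPoissonRandomMeasure P ν N) {ι : Type*} [Fintype ι]
    {C : ι → Set S} (hC : ∀ i, MeasurableSet (C i)) (hd : Pairwise fun i j => Disjoint (C i) (C j)) :
    iIndepFun (fun i θ => N θ (C i)) P := by
  have e := Fintype.equivFin ι
  have := (hN.indep _ (C ∘ e.symm) (fun i => hC _)
    (fun i j hij => hd (e.symm.injective.ne hij))).precomp e.injective
  simpa using this

lemma map_toReal (hN : IsPoissonRandomMeasure P ν N) {C : Set S} (hC : MeasurableSet C)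
    (h : ν C ≠ ∞) : P.map (fun θ => (N θ).real C)
      = (poissonMeasure (ν C).toNNReal).map (fun n : ℕ => (n : ℝ)) := by
  have h1 := congrArg (Measure.map ENNReal.toReal) (hN.law C hC)
  rw [poissonLaw, if_neg h, Measure.map_map ENNReal.measurable_toReal (hN.measurable_apply hC),
    Measure.map_map ENNReal.measurable_toReal .of_discrete] at h1
  simpa [Function.comp_def, Measure.real] using h1

lemma measurable_real (hN : IsPoissonRandomMeasure P ν N) {C : Set S} (hC : MeasurableSet C) :
    Measurable fun θ => (N θ).real C :=
  (hN.measurable_apply hC).ennreal_toReal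

lemma memLp_real (hN : IsPoissonRandomMeasure P ν N) {C : Set S} (hC : MeasurableSet C)
    (h : ν C ≠ ∞) : MemLp (fun θ => (N θ).real C) 2 P := by
  have := memLp_map_measure_iff (μ := P) (p := 2) (f := fun θ => (N θ).real C) (g := (id : ℝ → ℝ))
    aestronglyMeasurable_id (hN.measurable_real hC).aemeasurable
  rw [hN.map_toReal hC h, memLp_map_measure_iff aestronglyMeasurable_id .of_discrete] at this
  exact this.1 (memLp_two_poisson _)

lemma integral_real (hN : IsPoissonRandomMeasure P ν N) {C : Set S} (hC : MeasurableSet C)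
    (h : ν C ≠ ∞) : ∫ θ, (N θ).real C ∂P = ν.real C := by
  have := integral_map (μ := P) (f := (id : ℝ → ℝ)) (hN.measurable_real hC).aemeasurable
    aestronglyMeasurable_id
  rw [hN.map_toReal hC h, integral_map .of_discrete aestronglyMeasurable_id] at this
  simpa [integral_poisson, Measure.real, ENNReal.coe_toNNReal_eq_toReal] using this.symm

lemma variance_real (hN : IsPoissonRandomMeasure P ν N) {C : Set S} (hC : MeasurableSet C)
    (h : ν C ≠ ∞) : variance (fun θ => (N θ).real C) P = ν.real C := by
  have := variance_map (μ := P) (X := (id : ℝ → ℝ)) (Y := fun θ => (N θ).real C)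
    aemeasurable_id (hN.measurable_real hC).aemeasurable
  rw [hN.map_toReal hC h, variance_map aemeasurable_id .of_discrete] at this
  simpa [Function.comp_def, variance_poisson, Measure.real, ENNReal.coe_toNNReal_eq_toReal]
    using this.symm

variable [IsProbabilityMeasure P]

/-- The integral is a linear combination of independent Poisson masses of the fibres, and each mass
has variance equal to its mean. -/
lemma lintegral_sq_centeredIntegral_simpleFunc (hN : IsPoissonRandomMeasure P ν N)
    (G : SimpleFunc S ℝ) (hG : Integrable G ν) :
    ∫⁻ θ, ‖centeredIntegral ν N G θ‖ₑ ^ 2 ∂P = ∫⁻ s, ‖G s‖ₑ ^ 2 ∂ν := by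
  -- The fibre over `0` may have infinite intensity, hence the separate case `v = 0` below.
  have hfib : ∀ v : ℝ, v ≠ 0 → ν (G ⁻¹' {v}) ≠ ∞ := fun v hv =>
    (SimpleFunc.integrable_iff_finMeasSupp.1 hG |>.meas_preimage_singleton_ne_zero hv).ne
  have hm : ∀ v : ℝ, MeasurableSet (G ⁻¹' {v}) := fun v => G.measurableSet_fiber v
  let Y : ℝ → Θ → ℝ := fun v θ => v * (N θ).real (G ⁻¹' {v})
  have hY2 : ∀ v, MemLp (Y v) 2 P := by
    intro v
    by_cases hv : v = 0
    · simp [Y, hv]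
    · exact (hN.memLp_real (hm v) (hfib v hv)).const_mul v
  have hYm : ∀ v, ∫ θ, Y v θ ∂P = v * ν.real (G ⁻¹' {v}) := by
    intro v
    by_cases hv : v = 0
    · simp [Y, hv]
    · rw [integral_const_mul, hN.integral_real (hm v) (hfib v hv)]
  have hYv : ∀ v, variance (Y v) P = v ^ 2 * ν.real (G ⁻¹' {v}) := by
    intro v
    by_cases hv : v = 0
    · have : Y v = 0 := by ext; simp [Y, hv]
      rw [this, variance_zero]; simp [hv]
    · rw [variance_const_mul, hN.variance_real (hm v) (hfib v hv)]
  have hX : (fun θ => ∫ s, G s ∂(N θ)) =ᵐ[P] ∑ v ∈ G.range, Y v := by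
    filter_upwards [hN.ae_integrable G.measurable hG] with θ hθ
    rw [← SimpleFunc.integral_eq_integral _ hθ, SimpleFunc.integral_eq]
    simp [Y, mul_comm]
  have hXm : P[∑ v ∈ G.range, Y v] = ∫ s, G s ∂ν := by
    rw [← SimpleFunc.integral_eq_integral _ hG, SimpleFunc.integral_eq]
    simp only [Finset.sum_apply]
    rw [integral_finsetSum _ fun v _ => (hY2 v).integrable one_le_two]
    simp [hYm, mul_comm]
  have hXv : variance (∑ v ∈ G.range, Y v) P = ∑ v ∈ G.range, v ^ 2 * ν.real (G ⁻¹' {v}) := by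
    rw [IndepFun.variance_sum (fun v _ => hY2 v)]
    · simp [hYv]
    · intro v _ w _ hvw
      -- Additivity of the variance needs only pairwise independence, so two fibres are enough.
      have := hN.iIndepFun_fintype (C := ![G ⁻¹' {v}, G ⁻¹' {w}]) (by simp [Fin.forall_fin_two, hm])
        (by
          have hd : Disjoint (G ⁻¹' {v}) (G ⁻¹' {w}) :=
            Disjoint.preimage _ (by simpa using hvw)
          intro i j hij
          fin_cases i <;> fin_cases j <;> simp_all [disjoint_comm])
      have h01 := this.indepFun (i := 0) (j := 1) (by decide)
      exact h01.comp (φ := fun x => v * x.toReal) (ψ := fun x => w * x.toReal)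
        (by fun_prop) (by fun_prop)
  have hsum : MemLp (∑ v ∈ G.range, Y v) 2 P := memLp_finsetSum' _ fun v _ => hY2 v
  calc ∫⁻ θ, ‖centeredIntegral ν N G θ‖ₑ ^ 2 ∂P
      = evariance (∑ v ∈ G.range, Y v) P := by
        rw [evariance, hXm]
        refine lintegral_congr_ae ?_
        filter_upwards [hX] with θ hθ
        simp only [centeredIntegral, hθ]
    _ = ENNReal.ofReal (∑ v ∈ G.range, v ^ 2 * ν.real (G ⁻¹' {v})) := by
        rw [← hsum.ofReal_variance_eq, hXv]
    _ = ∑ v ∈ G.range, ‖v‖ₑ ^ 2 * ν (G ⁻¹' {v}) := by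
        rw [ENNReal.ofReal_sum_of_nonneg fun v _ => by positivity]
        refine Finset.sum_congr rfl fun v _ => ?_
        by_cases hv : v = 0
        · simp [hv]
        · rw [ENNReal.ofReal_mul (by positivity), ofReal_measureReal (hfib v hv), ← sq_abs,
            ENNReal.ofReal_pow (abs_nonneg v), Real.enorm_eq_ofReal_abs]
    _ = ∫⁻ s, ‖G s‖ₑ ^ 2 ∂ν := by
        have := (G.map fun v => ‖v‖ₑ ^ 2).lintegral_eq_lintegral ν
        rw [SimpleFunc.map_lintegral] at this
        rw [← this]; rfl

/-- The centered integral is a contraction from `L¹(ν) ∩ L²(ν)`, with the norm of `L²(ν)`, to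
`L²(P)`. -/
lemma lintegral_sq_centeredIntegral_le (hN : IsPoissonRandomMeasure P ν N) {G : S → ℝ}
    (hGm : Measurable G) (hG : Integrable G ν) :
    ∫⁻ θ, ‖centeredIntegral ν N G θ‖ₑ ^ 2 ∂P ≤ ∫⁻ s, ‖G s‖ₑ ^ 2 ∂ν := by
  by_cases hfin : ∫⁻ s, ‖G s‖ₑ ^ 2 ∂ν = ∞
  · simp [hfin]
  let A : ℕ → SimpleFunc S ℝ := SimpleFunc.approxOn G hGm univ 0 (mem_univ _)
  have hAlim : ∀ s, Tendsto (fun n => A n s) atTop (𝓝 (G s)) := fun s =>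
    SimpleFunc.tendsto_approxOn hGm (mem_univ _) (by simp)
  have hAb : ∀ n s, ‖A n s‖ ≤ ‖G s‖ + ‖G s‖ := fun n s =>
    SimpleFunc.norm_approxOn_zero_le hGm (mem_univ _) s n
  have hAint : ∀ n (μ : Measure S), Integrable G μ → Integrable (A n) μ := fun n μ hμ =>
    SimpleFunc.integrable_approxOn hGm hμ (mem_univ _) (integrable_zero _ _ _) n
  have hlim : ∀ μ : Measure S, Integrable G μ →
      Tendsto (fun n => ∫ s, A n s ∂μ) atTop (𝓝 (∫ s, G s ∂μ)) := fun μ hμ =>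
    tendsto_integral_of_dominated_convergence (fun s => ‖G s‖ + ‖G s‖)
      (fun n => (A n).measurable.aestronglyMeasurable) (hμ.norm.add hμ.norm)
      (fun n => Eventually.of_forall (hAb n)) (Eventually.of_forall hAlim)
  have hmeas : ∀ n, AEMeasurable (fun θ => ‖centeredIntegral ν N (A n) θ‖ₑ ^ 2) P := by
    intro n
    have := hN.measurable_integral (A n).measurable
    exact (((this.sub_const _).enorm).pow_const 2).aemeasurable
  have h2 : Tendsto (fun n => ∫⁻ s, ‖A n s‖ₑ ^ 2 ∂ν) atTop (𝓝 (∫⁻ s, ‖G s‖ₑ ^ 2 ∂ν)) := by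
    -- The approximants satisfy `‖A n s‖ ≤ 2‖G s‖`, whence the `4`.
    refine tendsto_lintegral_of_dominated_convergence (fun s => 4 * ‖G s‖ₑ ^ 2)
      (fun n => by fun_prop) (fun n => Eventually.of_forall fun s => ?_) ?_
      (Eventually.of_forall fun s => ?_)
    · have : ‖A n s‖ₑ ≤ ‖G s‖ₑ + ‖G s‖ₑ := by
        rw [← ofReal_norm, ← ofReal_norm, ← ENNReal.ofReal_add (by positivity)
          (by positivity)]
        exact ENNReal.ofReal_le_ofReal (hAb n s)
      calc ‖A n s‖ₑ ^ 2 ≤ (‖G s‖ₑ + ‖G s‖ₑ) ^ 2 := by gcongr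
        _ = 4 * ‖G s‖ₑ ^ 2 := by ring
    · rw [lintegral_const_mul _ (by fun_prop)]
      exact ENNReal.mul_ne_top (by simp) hfin
    · exact ((ENNReal.continuous_pow 2).tendsto _).comp ((continuous_enorm.tendsto _).comp (hAlim s))
  -- Almost sure convergence along the approximants and Fatou's lemma; the inequality is all that is
  -- needed later.
  calc ∫⁻ θ, ‖centeredIntegral ν N G θ‖ₑ ^ 2 ∂P
      = ∫⁻ θ, liminf (fun n => ‖centeredIntegral ν N (A n) θ‖ₑ ^ 2) atTop ∂P := by
        refine lintegral_congr_ae ?_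
        filter_upwards [hN.ae_integrable hGm hG] with θ hθ
        refine (Tendsto.liminf_eq ?_).symm
        refine ((ENNReal.continuous_pow 2).tendsto _).comp ((continuous_enorm.tendsto _).comp ?_)
        exact (hlim _ hθ).sub (hlim _ hG)
    _ ≤ liminf (fun n => ∫⁻ θ, ‖centeredIntegral ν N (A n) θ‖ₑ ^ 2 ∂P) atTop :=
        lintegral_liminf_le' hmeas
    _ = liminf (fun n => ∫⁻ s, ‖A n s‖ₑ ^ 2 ∂ν) atTop := by
        simp only [hN.lintegral_sq_centeredIntegral_simpleFunc _ (hAint _ _ hG)]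
    _ = ∫⁻ s, ‖G s‖ₑ ^ 2 ∂ν := h2.liminf_eq

end IsPoissonRandomMeasure

end PoissonRandomMeasure

/-! ### Convergence in measure. -/

section InMeasure

variable {Θ : Type*} [MeasurableSpace Θ] {P : Measure Θ}

lemma tendstoInMeasure_add {ι : Type*} {l : Filter ι} {f g : ι → Θ → ℝ} {f' g' : Θ → ℝ}
    (hf : TendstoInMeasure P f l f') (hg : TendstoInMeasure P g l g') :
    TendstoInMeasure P (fun i θ => f i θ + g i θ) l (fun θ => f' θ + g' θ) := by
  intro ε hε
  have hε2 : 0 < ε / 2 := ENNReal.half_pos hε.ne'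
  have := (hf _ hε2).add (hg _ hε2)
  rw [add_zero] at this
  refine tendsto_of_tendsto_of_tendsto_of_le_of_le tendsto_const_nhds this (fun _ => zero_le)
    fun i => (measure_mono fun θ hθ => ?_).trans (measure_union_le _ _)
  by_contra hcon
  simp only [mem_union, mem_ofPred_eq, not_or, not_le] at hcon hθ
  have h1 := edist_add_add_le (f i θ) (g i θ) (f' θ) (g' θ)
  have h2 := ENNReal.add_lt_add hcon.1 hcon.2
  rw [ENNReal.add_halves] at h2
  exact absurd (hθ.trans h1) (not_le.2 h2)

/-- Reduces `ε → 0` to sequences, for which almost sure convergence implies convergence in measure.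
-/
lemma tendstoInMeasure_nhdsGT_of_seq {f : ℝ → Θ → ℝ} {g : Θ → ℝ}
    (h : ∀ u : ℕ → ℝ, (∀ n, 0 < u n) → Tendsto u atTop (𝓝 0) →
      TendstoInMeasure P (fun n => f (u n)) atTop g) :
    TendstoInMeasure P f (𝓝[>] 0) g := by
  intro δ hδ
  refine tendsto_of_seq_tendsto fun u hu => ?_
  rw [tendsto_nhdsWithin_iff] at hu
  classical
  -- A sequence tending to `0` within `(0, ∞)` is only eventually positive; the value `1` is
  -- arbitrary.
  have heq : (fun n => if 0 < u n then u n else 1) =ᶠ[atTop] u := by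
    filter_upwards [hu.2] with n hn
    exact if_pos hn
  have := h (fun n => if 0 < u n then u n else 1)
    (fun n => by split_ifs with h <;> simp_all) (hu.1.congr' heq.symm) δ hδ
  refine this.congr' ?_
  filter_upwards [heq] with n hn
  simp only [hn, Function.comp]

lemma tendstoInMeasure_comp_fst {Θ' : Type*} [MeasurableSpace Θ'] (Q : Measure Θ')
    [IsProbabilityMeasure Q] [SFinite P] {ι : Type*} {l : Filter ι} {f : ι → Θ → ℝ} {g : Θ → ℝ}
    (h : TendstoInMeasure P f l g) :
    TendstoInMeasure (P.prod Q) (fun i q => f i q.1) l (fun q => g q.1) := by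
  intro ε hε
  refine (h ε hε).congr fun i => ?_
  have : {q : Θ × Θ' | ε ≤ edist (f i q.1) (g q.1)} = {θ | ε ≤ edist (f i θ) (g θ)} ×ˢ univ := by
    ext q; simp
  rw [this, Measure.prod_prod, measure_univ, mul_one]

end InMeasure

/-! ### Almost sure integrability and limits of truncated integrals. -/

section PoissonRandomMeasure

variable {Θ S : Type*} [MeasurableSpace Θ] [MeasurableSpace S] {P : Measure Θ}
  {ν : Measure S} {N : Θ → Measure S}

lemma eLpNorm_two_eq {T : Type*} [MeasurableSpace T] (μ : Measure T) (f : T → ℝ) :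
    eLpNorm f 2 μ = (∫⁻ t, ‖f t‖ₑ ^ 2 ∂μ) ^ (1 / 2 : ℝ) := by
  rw [eLpNorm_eq_lintegral_rpow_enorm_toReal (by simp) (by simp)]
  simp

namespace IsPoissonRandomMeasure

lemma ae_ae (hN : IsPoissonRandomMeasure P ν N) {p : S → Prop} (hp : ∀ᵐ s ∂ν, p s) :
    ∀ᵐ θ ∂P, ∀ᵐ s ∂(N θ), p s := by
  filter_upwards [hN.ae_eq_zero (measurableSet_toMeasurable ν {s | ¬ p s})
    (by rw [measure_toMeasurable]; exact hp)] with θ hθ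
  exact measure_mono_null (subset_toMeasurable _ _) hθ

lemma measurable_centeredIntegral (hN : IsPoissonRandomMeasure P ν N) {G : S → ℝ}
    (hG : Measurable G) : Measurable (centeredIntegral ν N G) :=
  (hN.measurable_integral hG).sub_const _

/-- On a set of finite intensity every measurable function is almost surely integrable. -/
lemma ae_integrableOn (hN : IsPoissonRandomMeasure P ν N) {C : Set S} (hC : MeasurableSet C)
    (h : ν C < ∞) {F : S → ℝ} (hF : Measurable F) : ∀ᵐ θ ∂P, IntegrableOn F C (N θ) := by
  -- The probability that every `B n` has mass at least `1` is at most `ν (B n) → 0`. As these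
  -- masses are `0` or at least `1`, some `B n` is almost surely empty of points, and `F` is then
  -- bounded on `C`, `N θ`-almost everywhere.
  let B : ℕ → Set S := fun n => C ∩ {s | (n : ℝ) < ‖F s‖}
  have hB : ∀ n, MeasurableSet (B n) := fun n =>
    hC.inter (measurableSet_lt measurable_const hF.norm)
  have hBanti : Antitone B := fun m n hmn s hs =>
    ⟨hs.1, show (m : ℝ) < ‖F s‖ from (Nat.cast_le.2 hmn).trans_lt hs.2⟩
  have hBfin : ∀ n, ν (B n) < ∞ := fun n => (measure_mono inter_subset_left).trans_lt h
  have hBempty : ⋂ n, B n = ∅ := by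
    ext s
    simp only [mem_iInter, mem_empty_iff_false, iff_false, not_forall]
    obtain ⟨n, hn⟩ := exists_nat_ge ‖F s‖
    exact ⟨n, fun hs => absurd hs.2 (not_lt.2 hn)⟩
  have hBlim : Tendsto (fun n => ν (B n)) atTop (𝓝 0) := by
    have := tendsto_measure_iInter_atTop (fun n => (hB n).nullMeasurableSet) hBanti
      ⟨0, (hBfin 0).ne⟩
    rwa [hBempty, measure_empty] at this
  have hzero : ∀ᵐ θ ∂P, ∃ n, N θ (B n) < 1 := by
    have hle : ∀ n, P {θ | ¬ ∃ n, N θ (B n) < 1} ≤ ν (B n) := fun n => by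
      have h1 := meas_ge_le_lintegral_div (μ := P) (hN.measurable_apply (hB n)).aemeasurable
        one_ne_zero ENNReal.one_ne_top
      rw [div_one, ← Measure.bind_apply (hB n) hN.measurable.aemeasurable, hN.bind_eq] at h1
      refine (measure_mono fun θ hθ => ?_).trans h1
      simp only [not_exists, not_lt, mem_ofPred_eq] at hθ ⊢
      exact hθ n
    exact le_antisymm (ge_of_tendsto' hBlim hle) zero_le
  have hint : ∀ᵐ θ ∂P, ∀ n, N θ (B n) = 0 ∨ 1 ≤ N θ (B n) := by
    rw [ae_all_iff]
    intro n
    have hl : ∀ᵐ x ∂(poissonLaw (ν (B n))), x = 0 ∨ 1 ≤ x := by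
      rw [poissonLaw, if_neg (hBfin n).ne]
      refine (ae_map_iff .of_discrete ?_).2 (Eventually.of_forall fun k => ?_)
      · exact (measurableSet_singleton _).union measurableSet_Ici
      · rcases Nat.eq_zero_or_pos k with rfl | hk
        · simp
        · right; exact_mod_cast hk
    rw [← hN.law _ (hB n)] at hl
    exact ae_of_ae_map (hN.measurable_apply (hB n)).aemeasurable hl
  filter_upwards [hzero, hint, hN.ae_lt_top hC h] with θ ⟨n, hn⟩ hi hfin
  have h0 : N θ (B n) = 0 := (hi n).resolve_right (not_le.2 hn)
  refine IntegrableOn.of_bound hfin hF.aestronglyMeasurable n ?_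
  rw [ae_restrict_iff' hC]
  have : ∀ᵐ s ∂(N θ), s ∉ B n := measure_eq_zero_iff_ae_notMem.1 h0
  filter_upwards [this] with s hs hsC
  by_contra hcon
  exact hs ⟨hsC, not_le.1 hcon⟩

/-- If `∫ min(1, |F|) dν < ∞` then `∫ F dN` converges almost surely. -/
lemma ae_integrable_of_min (hN : IsPoissonRandomMeasure P ν N) {F : S → ℝ} (hF : Measurable F)
    (h : ∫⁻ s, min 1 ‖F s‖ₑ ∂ν < ∞) : ∀ᵐ θ ∂P, Integrable F (N θ) := by
  -- Large values occupy a set of finite intensity; the remaining part of `F` is in `L¹(ν)`.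
  let C : Set S := {s | 1 < ‖F s‖ₑ}
  have hC : MeasurableSet C := measurableSet_lt measurable_const hF.enorm
  have hCfin : ν C < ∞ := by
    refine lt_of_le_of_lt ?_ h
    rw [← lintegral_indicator_one hC]
    refine lintegral_mono fun s => ?_
    by_cases hs : s ∈ C
    · simpa [hs] using (le_of_lt hs)
    · simp [hs]
  have hD : Integrable (Cᶜ.indicator F) ν := by
    refine ⟨(hF.indicator hC.compl).aestronglyMeasurable, lt_of_le_of_lt (lintegral_mono fun s => ?_) h⟩
    by_cases hs : s ∈ C
    · simp [hs]
    · have : ‖F s‖ₑ ≤ 1 := not_lt.1 hs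
      simp [hs, this]
  filter_upwards [hN.ae_integrableOn hC hCfin hF, hN.ae_integrable (hF.indicator hC.compl) hD]
    with θ h1 h2
  rw [integrable_indicator_iff hC.compl] at h2
  rw [← integrableOn_univ, ← union_compl_self C]
  exact h1.union h2

/-- By `ae_ae`, a `ν`-null set is almost surely `N θ`-null, so dominated convergence applies for
fixed `θ`. -/
lemma ae_tendsto_setIntegral (hN : IsPoissonRandomMeasure P ν N) {A : ℕ → Set S}
    (hA : ∀ n, MeasurableSet (A n)) (hlim : ∀ᵐ s ∂ν, ∀ᶠ n in atTop, s ∈ A n) {F : S → ℝ}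
    (hFm : Measurable F) (hF : ∀ᵐ θ ∂P, Integrable F (N θ)) :
    ∀ᵐ θ ∂P, Tendsto (fun n => ∫ s in A n, F s ∂(N θ)) atTop (𝓝 (∫ s, F s ∂(N θ))) := by
  filter_upwards [hN.ae_ae hlim, hF] with θ hθ hFθ
  simp_rw [← integral_indicator (hA _)]
  refine tendsto_integral_of_dominated_convergence (fun s => ‖F s‖)
    (fun n => (hFm.indicator (hA n)).aestronglyMeasurable) hFθ.norm
    (fun n => Eventually.of_forall fun s => norm_indicator_le_norm_self _ _) ?_
  filter_upwards [hθ] with s hs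
  refine tendsto_const_nhds.congr' ?_
  filter_upwards [hs] with n hn
  simp [hn]

variable [IsProbabilityMeasure P]

lemma eLpNorm_centeredIntegral_le (hN : IsPoissonRandomMeasure P ν N) {G : S → ℝ}
    (hGm : Measurable G) (hG : Integrable G ν) :
    eLpNorm (centeredIntegral ν N G) 2 P ≤ eLpNorm G 2 ν := by
  rw [eLpNorm_two_eq, eLpNorm_two_eq]
  exact ENNReal.rpow_le_rpow (hN.lintegral_sq_centeredIntegral_le hGm hG) (by norm_num)

lemma eLpNorm_centeredIntegral_sub_le (hN : IsPoissonRandomMeasure P ν N) {G G' : S → ℝ}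
    (hGm : Measurable G) (hG : Integrable G ν) (hGm' : Measurable G') (hG' : Integrable G' ν) :
    eLpNorm (centeredIntegral ν N G - centeredIntegral ν N G') 2 P ≤ eLpNorm (G - G') 2 ν := by
  refine le_trans (eLpNorm_congr_ae ?_).le
    (hN.eLpNorm_centeredIntegral_le (hGm.sub hGm') (hG.sub hG'))
  filter_upwards [hN.ae_integrable hGm hG, hN.ae_integrable hGm' hG'] with θ h h'
  simp only [centeredIntegral, Pi.sub_apply]
  rw [integral_sub h h', integral_sub hG hG']
  ring

lemma tendsto_eLpNorm_indicator_sub {A : ℕ → Set S} (hA : ∀ n, MeasurableSet (A n))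
    (hlim : ∀ᵐ s ∂ν, ∀ᶠ n in atTop, s ∈ A n) {F : S → ℝ} (hF : MemLp F 2 ν) :
    Tendsto (fun n => eLpNorm ((A n).indicator F - F) 2 ν) atTop (𝓝 0) := by
  simp_rw [eLpNorm_two_eq]
  have hfin : ∫⁻ s, ‖F s‖ₑ ^ 2 ∂ν ≠ ∞ := by
    have := hF.2
    rw [eLpNorm_two_eq] at this
    intro h
    simp [h] at this
  have : Tendsto (fun n => ∫⁻ s, ‖((A n).indicator F - F) s‖ₑ ^ 2 ∂ν) atTop (𝓝 (∫⁻ _, 0 ∂ν)) := by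
    refine tendsto_lintegral_of_dominated_convergence' (fun s => ‖F s‖ₑ ^ 2)
      (fun n => ?_) (fun n => Eventually.of_forall fun s => ?_) hfin ?_
    · exact (((hF.1.indicator (hA n)).sub hF.1).enorm.pow_const 2)
    · by_cases hs : s ∈ A n <;> simp [hs]
    · filter_upwards [hlim] with s hs
      refine tendsto_const_nhds.congr' ?_
      filter_upwards [hs] with n hn
      simp [hn]
  rw [lintegral_zero] at this
  simpa using this.ennrpow_const (1 / 2)

/-- The compensated integral of `F ∈ L²(ν)` is the limit in `L²(P)` of the centered integrals of
its truncations. -/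
lemma tendsto_l2CompensatedIntegral (hN : IsPoissonRandomMeasure P ν N) {A : ℕ → Set S}
    (hA : ∀ n, MeasurableSet (A n)) (hAfin : ∀ n, ν (A n) < ∞)
    (hlim : ∀ᵐ s ∂ν, ∀ᶠ n in atTop, s ∈ A n) {F : S → ℝ} (hFm : Measurable F)
    (hF : MemLp F 2 ν) :
    MemLp (l2CompensatedIntegral P ν N F) 2 P ∧
    Tendsto (fun n => eLpNorm (centeredIntegral ν N ((A n).indicator F)
      - l2CompensatedIntegral P ν N F) 2 P) atTop (𝓝 0) := by
  have hGm : ∀ n, Measurable ((A n).indicator F) := fun n => hFm.indicator (hA n)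
  have hG2 : ∀ n, MemLp ((A n).indicator F) 2 ν := fun n => hF.indicator (hA n)
  have hG1 : ∀ n, Integrable ((A n).indicator F) ν := fun n => by
    rw [integrable_indicator_iff (hA n)]
    have : IsFiniteMeasure (ν.restrict (A n)) := ⟨by simpa using hAfin n⟩
    exact (hF.restrict (A n)).integrable one_le_two
  have hX2 : ∀ n, MemLp (centeredIntegral ν N ((A n).indicator F)) 2 P := fun n =>
    ⟨(hN.measurable_centeredIntegral (hGm n)).aestronglyMeasurable,
      (hN.eLpNorm_centeredIntegral_le (hGm n) (hG1 n)).trans_lt (hG2 n).2⟩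
  have hGF := tendsto_eLpNorm_indicator_sub hA hlim hF
  -- The contraction carries the Cauchy property of the truncations from `L²(ν)` to the complete
  -- space `L²(P)`.
  have hex : ∃ Y, IsL2CompensatedIntegral P ν N F Y := by
    have hc : CauchySeq fun n => (hG2 n).toLp _ :=
      ((Lp.tendsto_Lp_iff_tendsto_eLpNorm'' _ hG2 F hF).2 hGF).cauchySeq
    have hc' : CauchySeq fun n => (hX2 n).toLp _ := by
      rw [EMetric.cauchySeq_iff] at hc ⊢
      intro ε hε
      obtain ⟨n₀, hn₀⟩ := hc ε hε
      refine ⟨n₀, fun m hm n hn => lt_of_le_of_lt ?_ (hn₀ m hm n hn)⟩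
      rw [Lp.edist_toLp_toLp, Lp.edist_toLp_toLp]
      exact hN.eLpNorm_centeredIntegral_sub_le (hGm m) (hG1 m) (hGm n) (hG1 n)
    obtain ⟨Y, hY⟩ := cauchySeq_tendsto_of_complete hc'
    refine ⟨Y, Lp.memLp Y, fun n => (A n).indicator F, fun n => ⟨hGm n, hG1 n, hG2 n⟩, hGF, ?_⟩
    have := (Lp.tendsto_Lp_iff_tendsto_eLpNorm'' _ hX2 Y (Lp.memLp Y)).1
      (by rwa [Lp.toLp_coeFn])
    exact this
  have hspec : IsL2CompensatedIntegral P ν N F (l2CompensatedIntegral P ν N F) := by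
    rw [l2CompensatedIntegral, dif_pos hex]
    exact hex.choose_spec
  set Y := l2CompensatedIntegral P ν N F
  obtain ⟨hY2, G, hG, hGF', hGY⟩ := hspec
  refine ⟨hY2, tendsto_of_tendsto_of_tendsto_of_le_of_le tendsto_const_nhds hGF
    (fun _ => zero_le) fun n => ?_⟩
  -- The chosen version comes with its own approximating sequence `G`; comparing the truncation with
  -- `G k` and letting `k → ∞` leaves only the truncation error.
  have hb : Tendsto (fun k => eLpNorm ((A n).indicator F - F) 2 ν + eLpNorm (G k - F) 2 ν
      + eLpNorm (centeredIntegral ν N (G k) - Y) 2 P) atTop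
      (𝓝 (eLpNorm ((A n).indicator F - F) 2 ν + 0 + 0)) :=
    (tendsto_const_nhds.add hGF').add hGY
  rw [add_zero, add_zero] at hb
  refine ge_of_tendsto' hb fun k => ?_
  have hXk : AEStronglyMeasurable (centeredIntegral ν N (G k)) P :=
    (hN.measurable_centeredIntegral (hG k).1).aestronglyMeasurable
  calc eLpNorm (centeredIntegral ν N ((A n).indicator F) - Y) 2 P
      = eLpNorm ((centeredIntegral ν N ((A n).indicator F) - centeredIntegral ν N (G k))
          + (centeredIntegral ν N (G k) - Y)) 2 P := by congr 1; abel
    _ ≤ eLpNorm (centeredIntegral ν N ((A n).indicator F) - centeredIntegral ν N (G k)) 2 P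
          + eLpNorm (centeredIntegral ν N (G k) - Y) 2 P :=
        eLpNorm_add_le ((hX2 n).1.sub hXk) (hXk.sub hY2.1) one_le_two
    _ ≤ eLpNorm ((A n).indicator F - G k) 2 ν + eLpNorm (centeredIntegral ν N (G k) - Y) 2 P := by
        gcongr
        exact hN.eLpNorm_centeredIntegral_sub_le (hGm n) (hG1 n) (hG k).1 (hG k).2.1
    _ = eLpNorm (((A n).indicator F - F) - (G k - F)) 2 ν
          + eLpNorm (centeredIntegral ν N (G k) - Y) 2 P := by congr 2; abel
    _ ≤ _ := by
        gcongr
        exact eLpNorm_sub_le ((hG2 n).1.sub hF.1) ((hG k).2.2.1.sub hF.1) one_le_two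

/-- Vanishing of the two `ν`-integrals allows the uncompensated integral over `A n` to be rewritten
with the `|H| ≤ 1` part centered, at no cost. That part converges in `L²(P)`, the rest almost
surely. -/
lemma tendstoInMeasure_setIntegral (hN : IsPoissonRandomMeasure P ν N) {A : ℕ → Set S}
    (hA : ∀ n, MeasurableSet (A n)) (hAfin : ∀ n, ν (A n) < ∞)
    (hlim : ∀ᵐ s ∂ν, ∀ᶠ n in atTop, s ∈ A n) {F H : S → ℝ} (hF : Measurable F) (hH : Measurable H)
    (hpois : ∫⁻ s, min 1 ‖F s - H s‖ₑ ∂ν < ∞) (hcomp : ∫⁻ s, min ‖H s‖ₑ (‖H s‖ₑ ^ 2) ∂ν < ∞)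
    (hsmall : ∀ n, ∫ s in A n, {s | |H s| ≤ 1}.indicator H s ∂ν = 0)
    (hlarge : ∫ s, {s | 1 < |H s|}.indicator H s ∂ν = 0) :
    TendstoInMeasure P (fun n θ => ∫ s in A n, F s ∂(N θ)) atTop
      (fun θ => (∫ s, (F s - H s) ∂(N θ)) + compensatedIntegral P ν N H θ) := by
  have hms : MeasurableSet {s | |H s| ≤ 1} := measurableSet_le hH.abs measurable_const
  have hml : MeasurableSet {s | 1 < |H s|} := measurableSet_lt measurable_const hH.abs
  set H₁ : S → ℝ := {s | |H s| ≤ 1}.indicator H with hH₁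
  set H₂ : S → ℝ := {s | 1 < |H s|}.indicator H with hH₂
  have hH₁m : Measurable H₁ := hH.indicator hms
  have hH₂m : Measurable H₂ := hH.indicator hml
  have hsum : ∀ s, H s = H₁ s + H₂ s := fun s => by
    by_cases hs : |H s| ≤ 1
    · simp [hH₁, hH₂, hs, not_lt.2 hs]
    · simp [hH₁, hH₂, hs, not_le.1 hs]
  have hH₁2 : MemLp H₁ 2 ν := by
    refine ⟨hH₁m.aestronglyMeasurable, ?_⟩
    rw [eLpNorm_two_eq]
    refine ENNReal.rpow_lt_top_of_nonneg (by norm_num)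
      (lt_of_le_of_lt (lintegral_mono fun s => ?_) hcomp).ne
    by_cases hs : |H s| ≤ 1
    · have h1 : ‖H s‖ₑ ≤ 1 := by
        rw [Real.enorm_eq_ofReal_abs]; exact ENNReal.ofReal_le_one.2 hs
      simp only [hH₁, hs, mem_ofPred_eq, indicator_of_mem, le_min_iff, le_refl, and_true]
      calc ‖H s‖ₑ ^ 2 = ‖H s‖ₑ * ‖H s‖ₑ := sq _
        _ ≤ ‖H s‖ₑ * 1 := by gcongr
        _ = _ := mul_one _
    · simp [hH₁, hs]
  have hH₂1 : Integrable H₂ ν := by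
    refine ⟨hH₂m.aestronglyMeasurable, lt_of_le_of_lt (lintegral_mono fun s => ?_) hcomp⟩
    by_cases hs : 1 < |H s|
    · have h1 : 1 ≤ ‖H s‖ₑ := by
        rw [Real.enorm_eq_ofReal_abs]; exact ENNReal.one_le_ofReal.2 hs.le
      simp only [hH₂, hs, mem_ofPred_eq, indicator_of_mem, le_min_iff, le_refl, true_and]
      calc ‖H s‖ₑ = ‖H s‖ₑ * 1 := (mul_one _).symm
        _ ≤ ‖H s‖ₑ * ‖H s‖ₑ := by gcongr
        _ = _ := (sq _).symm
    · simp [hH₂, hs]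
  have hD : ∀ᵐ θ ∂P, Integrable (fun s => F s - H s) (N θ) :=
    hN.ae_integrable_of_min (hF.sub hH) hpois
  have hI₂ := hN.ae_integrable hH₂m hH₂1
  have hsetm : ∀ n {G : S → ℝ}, Measurable G → Measurable fun θ => ∫ s in A n, G s ∂(N θ) := by
    intro n G hG
    simp_rw [← integral_indicator (hA n)]
    exact hN.measurable_integral (hG.indicator (hA n))
  have hE : TendstoInMeasure P
      (fun n θ => ∫ s in A n, ((F s - H s) + H₂ s) ∂(N θ)) atTop
      (fun θ => ∫ s, ((F s - H s) + H₂ s) ∂(N θ)) :=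
    tendstoInMeasure_of_tendsto_ae
      (fun n => (hsetm n ((hF.sub hH).add hH₂m)).aestronglyMeasurable)
      (hN.ae_tendsto_setIntegral hA hlim ((hF.sub hH).add hH₂m)
        (by filter_upwards [hD, hI₂] with θ h1 h2 using h1.add h2))
  obtain ⟨hY2, hY⟩ := hN.tendsto_l2CompensatedIntegral hA hAfin hlim hH₁m hH₁2
  have hL := tendstoInMeasure_of_tendsto_eLpNorm two_ne_zero
    (fun n => (hN.measurable_centeredIntegral (hH₁m.indicator (hA n))).aestronglyMeasurable)
    hY2.1 hY
  refine (tendstoInMeasure_add hE hL).congr (fun n => ?_) ?_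
  · filter_upwards [hD, hI₂, hN.ae_integrableOn (hA n) (hAfin n) hH₁m] with θ h1 h2 h3
    simp only [centeredIntegral]
    rw [integral_indicator (hA n), integral_indicator (hA n), hsmall n, sub_zero]
    refine (integral_add (f := fun s => F s - H s + H₂ s) (h1.add h2).integrableOn h3).symm.trans
      (integral_congr_ae (Eventually.of_forall fun s => ?_))
    simp only
    rw [hsum s]; ring
  · filter_upwards [hD, hI₂] with θ h1 h2
    simp only [compensatedIntegral, centeredIntegral, ← hH₁, ← hH₂, hlarge, sub_zero]
    rw [integral_add h1 h2]
    ring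

end IsPoissonRandomMeasure

end PoissonRandomMeasure

/-! ### Laws of random measures. -/

section FiniteDimensional

variable {S : Type*} [MeasurableSpace S]

/-- A law on the space of measures is determined by its finite-dimensional marginals. -/
lemma measure_ext_of_finite_marginals {κ₁ κ₂ : Measure (Measure S)} [IsFiniteMeasure κ₁]
    [IsFiniteMeasure κ₂]
    (h : ∀ I : Finset {C : Set S // MeasurableSet C},
      κ₁.map (fun m (C : I) => m C.1.1) = κ₂.map (fun m (C : I) => m C.1.1)) : κ₁ = κ₂ := by
  let Φ : Measure S → {C : Set S // MeasurableSet C} → ℝ≥0∞ := fun m C => m C.1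
  have hΦ : Measurable Φ := measurable_pi_lambda _ fun C => Measure.measurable_coe C.2
  -- Evaluations generate the σ-algebra on measures, so every measurable set is a preimage under
  -- `Φ`; uniqueness of projective limits then settles the laws on the product.
  have hcomap : (Measure.instMeasurableSpace : MeasurableSpace (Measure S))
      ≤ MeasurableSpace.comap Φ MeasurableSpace.pi := by
    refine iSup₂_le fun s hs => ?_
    rw [← measurable_iff_comap_le, ← BorelSpace.measurable_eq]
    exact (measurable_pi_apply (⟨s, hs⟩ : {C : Set S // MeasurableSet C})).comp
      (comap_measurable Φ)
  have hmap : κ₁.map Φ = κ₂.map Φ := by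
    have h1 : ∀ κ : Measure (Measure S), IsProjectiveLimit (κ.map Φ)
        (fun I => κ.map (fun m (C : I) => m C.1.1)) := fun κ I => by
      rw [Measure.map_map (Finset.measurable_restrict I) hΦ]
      rfl
    have h2 := h1 κ₂
    simp_rw [← h] at h2
    exact (h1 κ₁).unique h2
  ext B hB
  obtain ⟨B', hB', rfl⟩ := hcomap B hB
  rw [← Measure.map_apply hΦ hB', hmap, Measure.map_apply hΦ hB']

/-- Equality of a measure with a finite measure is decided on a countable family of sets. -/
lemma exists_countable_ext [MeasurableSpace.CountablyGenerated S] :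
    ∃ 𝒜 : Set (Set S), 𝒜.Countable ∧ (∀ s ∈ 𝒜, MeasurableSet s) ∧
      ∀ m m' : Measure S, IsFiniteMeasure m' → (∀ s ∈ 𝒜, m s = m' s) → m = m' := by
  let 𝒢 := MeasurableSpace.countableGeneratingSet S
  have hgen : MeasurableSpace.generateFrom (generateSetAlgebra 𝒢) = ‹MeasurableSpace S› := by
    rw [generateFrom_generateSetAlgebra_eq]
    exact MeasurableSpace.generateFrom_countableGeneratingSet
  refine ⟨generateSetAlgebra 𝒢,
    countable_generateSetAlgebra MeasurableSpace.countable_countableGeneratingSet, fun s hs => ?_,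
    fun m m' _ h => ?_⟩
  · rw [← hgen]; exact MeasurableSpace.measurableSet_generateFrom hs
  -- The countable algebra is a π-system containing `univ`, so the total masses agree too.
  · have hpi : IsPiSystem (generateSetAlgebra 𝒢) := fun s hs t ht _ =>
      isSetAlgebra_generateSetAlgebra.isSetRing.inter_mem hs ht
    refine (ext_of_generate_finite _ hgen.symm hpi (fun s hs => (h s hs).symm) ?_).symm
    exact (h _ isSetAlgebra_generateSetAlgebra.univ_mem).symm

end FiniteDimensional

/-! ### Transfer by an independent uniform variable. -/

section Transfer

/-- If `X` has the law of `M`, and `Y` is a random variable on the space of `M`, then `X` can be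
paired, using an independent uniform variable, with a copy of `Y` so that the pair has the law of
`(M, Y)`. -/
lemma exists_transfer {Θ T Ψ : Type*} [MeasurableSpace Θ] [MeasurableSpace T] [MeasurableSpace Ψ]
    [StandardBorelSpace Ψ] [Nonempty Ψ] (P : Measure Θ) [IsProbabilityMeasure P] (Q : Measure Ψ)
    [IsProbabilityMeasure Q] {X : Θ → T} (hX : Measurable X) {M : Ψ → T}
    (h : P.map X = Q.map M) :
    ∃ W : Θ × unitInterval → Ψ, Measurable W ∧
      (P.prod volume).map (fun q => (X q.1, W q)) = Q.map (fun p => (M p, p)) := by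
  -- The conditional law of the point of `Ψ` given `M`; `f` realizes it as a function of a uniform
  -- variable.
  let κ : Kernel T Ψ := condDistrib id M Q
  obtain ⟨f, hf, hfκ⟩ := κ.exists_measurable_map_eq_unitInterval
  have hW : Measurable fun q : Θ × unitInterval => f (X q.1) q.2 :=
    hf.comp ((hX.comp measurable_fst).prodMk measurable_snd)
  have hXW : Measurable fun q : Θ × unitInterval => (X q.1, f (X q.1) q.2) :=
    (hX.comp measurable_fst).prodMk hW
  refine ⟨fun q => f (X q.1) q.2, hW, ?_⟩
  have hc : Q.map (fun p => (M p, p)) = Q.map M ⊗ₘ κ :=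
    (compProd_map_condDistrib (X := M) (Y := id) (μ := Q) aemeasurable_id).symm
  rw [hc, ← h]
  ext s hs
  rw [Measure.map_apply hXW hs, Measure.prod_apply (hXW hs), Measure.compProd_apply hs,
    lintegral_map (Kernel.measurable_kernel_prodMk_left hs) hX]
  refine lintegral_congr fun θ => ?_
  have hfθ : Measurable (f (X θ)) := hf.comp measurable_prodMk_left
  rw [← hfκ, Measure.map_apply hfθ (measurable_prodMk_left hs)]
  rfl

end Transfer

/-! ### The canonical Poisson sample. -/

section CanonicalSample

variable {S : Type*} [MeasurableSpace S]

/-- The measure with unit masses at the first `p.1` points of the sequence `p.2`. -/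
def pointMeasure (p : ℕ × (ℕ → S)) : Measure S :=
  ∑ j ∈ Finset.range p.1, Measure.dirac (p.2 j)

instance (p : ℕ × (ℕ → S)) : IsFiniteMeasure (pointMeasure p) := by
  unfold pointMeasure; infer_instance

lemma measurable_pointMeasure : Measurable (pointMeasure (S := S)) := by
  refine measurable_from_prod_countable_right fun n => ?_
  unfold pointMeasure
  have : ∀ j, Measurable fun z : ℕ → S => Measure.dirac (z j) := fun j =>
    Measure.measurable_dirac.comp (measurable_pi_apply j)
  simp only
  fun_prop

lemma integral_pointMeasure (p : ℕ × (ℕ → S)) {f : S → ℝ} (hf : Measurable f) :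
    ∫ s, f s ∂(pointMeasure p) = ∑ j ∈ Finset.range p.1, f (p.2 j) := by
  rw [pointMeasure, integral_finsetSum_measure fun j _ =>
    integrable_dirac' hf.stronglyMeasurable (by simp)]
  simp [integral_dirac' _ _ hf.stronglyMeasurable]

variable [Nonempty S]

/-- The normalization of a finite measure (a point mass if the measure is zero). -/
def normalized (μ : Measure S) : Measure S :=
  open Classical in
  if μ = 0 then Measure.dirac (Classical.arbitrary S) else (μ univ)⁻¹ • μ

variable (μ : Measure S) [IsFiniteMeasure μ]

instance : IsProbabilityMeasure (normalized μ) := by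
  unfold normalized
  split_ifs with h
  · infer_instance
  · have : NeZero μ := ⟨h⟩
    exact isProbabilityMeasureSMul

lemma smul_normalized : μ univ • normalized μ = μ := by
  unfold normalized
  split_ifs with h
  · simp [h]
  · rw [smul_smul, ENNReal.mul_inv_cancel (by simpa using h) (measure_ne_top _ _), one_smul]

/-- The law of a Poisson number `J` of mean `μ(S)` and an independent i.i.d. sequence with the
normalized law. -/
def sampleLaw : Measure (ℕ × (ℕ → S)) :=
  (poissonMeasure (μ univ).toNNReal).prod (Measure.infinitePi fun _ => normalized μ)

instance : IsProbabilityMeasure (sampleLaw μ) := by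
  unfold sampleLaw; infer_instance

lemma sampleLaw_apply (n : ℕ) (B : Fin n → Set S) (hB : ∀ i, MeasurableSet (B i)) :
    sampleLaw μ ({p | p.1 = n} ∩ {p | ∀ i : Fin n, p.2 i ∈ B i})
      = poissonMeasure (μ univ).toNNReal {n} * ∏ i, (μ (B i) / μ univ) := by
  classical
  let B' : ℕ → Set S := fun k => if hk : k < n then B ⟨k, hk⟩ else univ
  have hset : ({p | p.1 = n} ∩ {p | ∀ i : Fin n, p.2 i ∈ B i} : Set (ℕ × (ℕ → S)))
      = {n} ×ˢ Set.pi (Finset.range n) B' := by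
    ext p
    simp only [mem_inter_iff, mem_ofPred_eq, mem_prod, mem_singleton_iff, Set.mem_pi,
      Finset.coe_range, mem_Iio, and_congr_right_iff]
    intro _
    constructor
    · intro h k hk
      simpa [B', hk] using h ⟨k, hk⟩
    · intro h i
      simpa [B'] using h i i.2
  have hB' : ∀ i ∈ Finset.range n, MeasurableSet (B' i) := fun i hi => by
    simp only [B', Finset.mem_range.1 hi, dite_true]
    exact hB _
  rw [hset, sampleLaw, Measure.prod_prod, Measure.infinitePi_pi _ hB', Finset.prod_range]
  -- For `μ = 0` the normalized law is a junk point mass: the product is empty when `n = 0`, and the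
  -- Poisson weight vanishes when `n > 0`.
  rcases eq_or_ne μ 0 with h0 | h0
  · rcases Nat.eq_zero_or_pos n with rfl | hn
    · simp
    · have : poissonMeasure (μ univ).toNNReal {n} = 0 := by
        rw [poissonMeasure_singleton]; simp [h0, hn.ne']
      simp [this]
  · congr 1
    refine Finset.prod_congr rfl fun i _ => ?_
    simp [B', normalized, h0, ENNReal.div_eq_inv_mul]

open Complex in
/-- The characteristic functional of the canonical Poisson sample. -/
lemma integral_cexp_pointMeasure {f : S → ℝ} (hf : Measurable f) :
    ∫ p, cexp ((∫ s, f s ∂(pointMeasure p) : ℝ) * I) ∂(sampleLaw μ)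
      = cexp (∫ s, (cexp (f s * I) - 1) ∂μ) := by
  set r := (μ univ).toNNReal with hr
  set ρ := normalized μ with hρ
  set c : ℂ := ∫ s, cexp (f s * I) ∂ρ with hc
  -- Given `n` points independence yields `c ^ n`; averaging over the Poisson number gives `exp (r
  -- (c - 1))`.
  have hprod : ∀ n : ℕ, ∫ z : ℕ → S, cexp ((∑ j ∈ Finset.range n, f (z j) : ℝ) * I)
      ∂(Measure.infinitePi fun _ => ρ) = c ^ n := fun n => by
    have hind : iIndepFun (fun (i : Fin n) (z : ℕ → S) => z i) (Measure.infinitePi fun _ => ρ) :=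
      (iIndepFun_infinitePi (P := fun _ : ℕ => ρ) (X := fun _ s => s)
        (fun _ => measurable_id)).precomp Fin.val_injective
    have := hind.integral_fun_prod_comp (f := fun _ s => cexp (f s * I))
      (fun i => (measurable_pi_apply _).aemeasurable)
      (fun i => by fun_prop)
    calc _ = ∫ z : ℕ → S, ∏ i : Fin n, cexp (f (z i) * I) ∂(Measure.infinitePi fun _ => ρ) := by
          refine integral_congr_ae (Eventually.of_forall fun z => ?_)
          simp only [Finset.sum_range]
          rw [← Complex.exp_sum, ← Finset.sum_mul]
          push_cast; rfl
      _ = ∏ i : Fin n, c := by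
          rw [this]
          refine Finset.prod_congr rfl fun i _ => ?_
          have hm := measurePreserving_eval_infinitePi (fun _ : ℕ => ρ) (i : ℕ)
          have := integral_map (μ := Measure.infinitePi fun _ : ℕ => ρ)
            (φ := Function.eval (i : ℕ)) (f := fun s => cexp (f s * I))
            (measurable_pi_apply _).aemeasurable (by fun_prop)
          rw [hm.map_eq] at this
          exact this.symm
      _ = c ^ n := by simp
  have hmeas : Measurable fun p : ℕ × (ℕ → S) =>
      cexp ((∫ s, f s ∂(pointMeasure p) : ℝ) * I) := by
    have := (hf.stronglyMeasurable.integral_kernel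
      (κ := ⟨pointMeasure, measurable_pointMeasure⟩)).measurable
    simp only [Kernel.coe_mk] at this
    fun_prop
  have hint : Integrable (fun p : ℕ × (ℕ → S) =>
      cexp ((∫ s, f s ∂(pointMeasure p) : ℝ) * I)) (sampleLaw μ) :=
    Integrable.of_bound hmeas.aestronglyMeasurable 1
      (Eventually.of_forall fun p => (norm_exp_ofReal_mul_I _).le)
  have hμ : ∫ s, (cexp (f s * I) - 1) ∂μ = r * (c - 1) := by
    have hi : Integrable (fun s => cexp (f s * I)) ρ :=
      Integrable.of_bound (by fun_prop) 1 (Eventually.of_forall fun p => (norm_exp_ofReal_mul_I _).le)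
    conv_lhs => rw [← smul_normalized μ]
    rw [integral_smul_measure, integral_sub hi (integrable_const _)]
    simp only [← hc, integral_const, probReal_univ, one_smul, Complex.real_smul]
    rfl
  rw [hμ]
  unfold sampleLaw at hint ⊢
  rw [integral_prod _ hint]
  simp_rw [integral_pointMeasure _ hf]
  simp only [← hρ, hprod]
  rw [integral_poissonMeasure]
  calc ∑' n : ℕ, (Real.exp (-r) * r ^ n / (n.factorial : ℝ)) • c ^ n
      = ∑' n : ℕ, (Real.exp (-r) : ℂ) * ((r * c) ^ n / n.factorial) := by
        refine tsum_congr fun n => ?_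
        rw [Complex.real_smul]
        push_cast
        ring
    _ = cexp (r * (c - 1)) := by
        rw [tsum_mul_left, (NormedSpace.expSeries_div_hasSum_exp ((r : ℂ) * c)).tsum_eq,
          ← Complex.exp_eq_exp_ℂ, ofReal_exp, ← Complex.exp_add]
        push_cast
        ring_nf

end CanonicalSample

/-! ### Poisson random measures of finite intensity. -/

section FiniteIntensity

variable {Θ S : Type*} [MeasurableSpace Θ] [MeasurableSpace S] {P : Measure Θ}
  {μ : Measure S} {N : Θ → Measure S}

lemma IsPoissonRandomMeasure.restrict (hN : IsPoissonRandomMeasure P μ N) {A : Set S}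
    (hA : MeasurableSet A) :
    IsPoissonRandomMeasure P (μ.restrict A) (fun θ => (N θ).restrict A) where
  measurable := Measure.measurable_of_measurable_coe _ fun C hC => by
    simp_rw [Measure.restrict_apply hC]
    exact hN.measurable_apply (hC.inter hA)
  law C hC := by
    simp_rw [Measure.restrict_apply hC]
    exact hN.law _ (hC.inter hA)
  indep n C hC hd := by
    simp_rw [Measure.restrict_apply (hC _)]
    exact hN.indep n _ (fun i => (hC i).inter hA)
      fun i j hij => (hd hij).mono inter_subset_left inter_subset_left

variable [IsFiniteMeasure μ]

open Complex in
/-- The characteristic functional of a Poisson random measure of finite intensity. -/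
lemma IsPoissonRandomMeasure.integral_cexp (hN : IsPoissonRandomMeasure P μ N)
    (f : SimpleFunc S ℝ) :
    ∫ θ, cexp ((∫ s, f s ∂(N θ) : ℝ) * I) ∂P = cexp (∫ s, (cexp (f s * I) - 1) ∂μ) := by
  have hm : ∀ v : ℝ, MeasurableSet (f ⁻¹' {v}) := fun v => f.measurableSet_fiber v
  -- The fibres of `f` are disjoint, so the functional factors into Poisson characteristic
  -- functions.
  have hind := hN.iIndepFun_fintype (C := fun v : f.range => f ⁻¹' {(v : ℝ)}) (fun v => hm _)
    (fun v w hvw => Disjoint.preimage _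
      (disjoint_singleton.2 fun hcon => hvw (Subtype.ext hcon)))
  have hprod := hind.integral_fun_prod_comp
    (f := fun (v : f.range) (x : ℝ≥0∞) => cexp (((v : ℝ) : ℂ) * (x.toReal : ℂ) * I))
    (fun v => (hN.measurable_apply (hm _)).aemeasurable) (fun v => by fun_prop)
  have hchar : ∀ v : ℝ, ∫ θ, cexp (v * (N θ (f ⁻¹' {v})).toReal * I) ∂P
      = cexp (μ.real (f ⁻¹' {v}) * (cexp (v * I) - 1)) := fun v => by
    have := charFun_map_cast_poissonMeasure (μ (f ⁻¹' {v})).toNNReal v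
    rw [show (Nat.cast : ℕ → ℝ) = fun n : ℕ => (n : ℝ) from rfl,
      ← hN.map_toReal (hm v) (measure_ne_top _ _), charFun_apply_real,
      integral_map (hN.measurable_real (hm v)).aemeasurable (by fun_prop)] at this
    exact this
  have hμ : ∫ s, (cexp (f s * I) - 1) ∂μ
      = ∑ v ∈ f.range, (μ.real (f ⁻¹' {v}) : ℂ) * (cexp (v * I) - 1) := by
    have h1 := f.map_integral (μ := μ) (fun v : ℝ => cexp (v * I) - 1)
      (SimpleFunc.integrable_of_isFiniteMeasure f) (by simp)
    rw [SimpleFunc.integral_eq_integral _ (SimpleFunc.integrable_of_isFiniteMeasure _)] at h1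
    simpa [Complex.real_smul] using h1
  rw [hμ, Complex.exp_sum, ← Finset.prod_coe_sort]
  simp_rw [← hchar]
  rw [← hprod]
  refine integral_congr_ae ?_
  filter_upwards [hN.ae_lt_top MeasurableSet.univ (measure_lt_top _ _)] with θ hθ
  have : IsFiniteMeasure (N θ) := ⟨hθ⟩
  rw [← SimpleFunc.integral_eq_integral _ (SimpleFunc.integrable_of_isFiniteMeasure f),
    SimpleFunc.integral_eq, ← Complex.exp_sum, ← Finset.sum_mul,
    Finset.sum_coe_sort f.range (fun v : ℝ => (v : ℂ) * ((N θ (f ⁻¹' {v})).toReal : ℂ))]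
  simp [Measure.real, mul_comm]

/-- The function is `∑ t i 1_{C i}`; the sets may overlap. Thus characteristic functions of joint
masses become values of the characteristic functional. -/
lemma exists_simpleFunc_indicator_sum {ι : Type*} [Fintype ι] (C : ι → Set S)
    (hC : ∀ i, MeasurableSet (C i)) (t : ι → ℝ) :
    ∃ f : SimpleFunc S ℝ, ∀ m : Measure S, IsFiniteMeasure m →
      ∫ s, f s ∂m = ∑ i, t i * m.real (C i) := by
  classical
  have key : ∀ I : Finset ι, ∃ f : SimpleFunc S ℝ, ∀ m : Measure S, IsFiniteMeasure m →
      ∫ s, f s ∂m = ∑ i ∈ I, t i * m.real (C i) := by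
    intro I
    induction I using Finset.induction_on with
    | empty => exact ⟨0, fun m _ => by simp⟩
    | insert a I ha ih =>
      obtain ⟨f, hf⟩ := ih
      refine ⟨(SimpleFunc.const S (t a)).restrict (C a) + f, fun m _ => ?_⟩
      rw [Finset.sum_insert ha, ← hf m inferInstance]
      simp only [SimpleFunc.coe_add, Pi.add_apply]
      rw [integral_add (SimpleFunc.integrable_of_isFiniteMeasure _)
        (SimpleFunc.integrable_of_isFiniteMeasure _)]
      congr 1
      rw [SimpleFunc.coe_restrict _ (hC a), integral_indicator (hC a)]
      simp [mul_comm]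
  exact key Finset.univ

variable [IsProbabilityMeasure P] [Nonempty S]

/-- A Poisson random measure of finite intensity has the law of the canonical Poisson sample. -/
lemma IsPoissonRandomMeasure.map_eq_map_pointMeasure (hN : IsPoissonRandomMeasure P μ N) :
    P.map N = (sampleLaw μ).map pointMeasure := by
  have hM := measurable_pointMeasure (S := S)
  have hNm := hN.measurable
  refine measure_ext_of_finite_marginals fun I => ?_
  have hev : Measurable fun (m : Measure S) (C : I) => m C.1.1 :=
    measurable_pi_lambda _ fun C => Measure.measurable_coe C.1.2
  -- Masses are almost surely finite, so the marginals can be compared as laws of real vectors, by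
  -- characteristic functions, and mapped back with `ENNReal.ofReal`.
  let R : Measure S → I → ℝ := fun m C => m.real C.1.1
  have hR : Measurable R := measurable_pi_lambda _ fun C =>
    (Measure.measurable_coe C.1.2).ennreal_toReal
  have hRN : Measurable fun θ => R (N θ) := hR.comp hNm
  have hRM : Measurable fun p => R (pointMeasure p) := hR.comp hM
  have hof : Measurable fun (x : I → ℝ) (C : I) => ENNReal.ofReal (x C) := by fun_prop
  have hreal : (P.map fun θ => R (N θ)) = (sampleLaw μ).map fun p => R (pointMeasure p) := by
    have i1 : IsProbabilityMeasure (P.map fun θ => R (N θ)) :=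
      Measure.isProbabilityMeasure_map hRN.aemeasurable
    have i2 : IsProbabilityMeasure ((sampleLaw μ).map fun p => R (pointMeasure p)) :=
      Measure.isProbabilityMeasure_map hRM.aemeasurable
    refine Measure.ext_of_charFunDual (funext fun L => ?_)
    classical
    have hL : ∀ x : I → ℝ, L x = ∑ C, L (Pi.single C 1) * x C := fun x => by
      conv_lhs => rw [pi_eq_sum_univ' x]
      rw [map_sum]
      refine Finset.sum_congr rfl fun C _ => ?_
      rw [map_smul, smul_eq_mul, mul_comm]
    obtain ⟨f, hf⟩ := exists_simpleFunc_indicator_sum (fun C : I => C.1.1) (fun C => C.1.2)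
      (fun C => L (Pi.single C 1))
    rw [charFunDual_apply, charFunDual_apply, integral_map hRN.aemeasurable (by fun_prop),
      integral_map hRM.aemeasurable (by fun_prop)]
    have e1 : ∫ θ, Complex.exp (L (R (N θ)) * Complex.I) ∂P
        = ∫ θ, Complex.exp ((∫ s, f s ∂(N θ) : ℝ) * Complex.I) ∂P := by
      refine integral_congr_ae ?_
      filter_upwards [hN.ae_lt_top MeasurableSet.univ (measure_lt_top _ _)] with θ hθ
      rw [hf (N θ) ⟨hθ⟩, hL]
    have e2 : ∫ p, Complex.exp (L (R (pointMeasure p)) * Complex.I) ∂(sampleLaw μ)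
        = ∫ p, Complex.exp ((∫ s, f s ∂(pointMeasure p) : ℝ) * Complex.I) ∂(sampleLaw μ) := by
      refine integral_congr_ae (Eventually.of_forall fun p => ?_)
      simp only
      rw [hf (pointMeasure p) inferInstance, hL]
    rw [e1, e2, hN.integral_cexp, integral_cexp_pointMeasure μ f.measurable]
  have h := congrArg (Measure.map fun (x : I → ℝ) (C : I) => ENNReal.ofReal (x C)) hreal
  rw [Measure.map_map hof hRN, Measure.map_map hof hRM] at h
  rw [Measure.map_map hev hNm, Measure.map_map hev hM]
  refine (Measure.map_congr ?_).trans (h.trans (Measure.map_congr ?_))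
  · filter_upwards [hN.ae_lt_top MeasurableSet.univ (measure_lt_top _ _)] with θ hθ
    have : IsFiniteMeasure (N θ) := ⟨hθ⟩
    ext C
    simp [R]
  · refine Eventually.of_forall fun p => ?_
    ext C
    simp [R]

/-- The points of a Poisson random measure of finite intensity can be listed, after an
enlargement of the probability space, as a Poisson sample. -/
lemma IsPoissonRandomMeasure.exists_isPoissonSample [StandardBorelSpace S]
    (hN : IsPoissonRandomMeasure P μ N) :
    ∃ (J : Θ × unitInterval → ℕ) (Z : ℕ → Θ × unitInterval → S),
      IsPoissonSample (P.prod volume) μ J Z ∧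
      ∀ᵐ q ∂(P.prod volume), N q.1 = ∑ j ∈ Finset.range (J q), Measure.dirac (Z j q) := by
  obtain ⟨W, hW, hlaw⟩ := exists_transfer P (sampleLaw μ) hN.measurable
    hN.map_eq_map_pointMeasure
  have hNW : Measurable fun q : Θ × unitInterval => (N q.1, W q) :=
    (hN.measurable.comp measurable_fst).prodMk hW
  have hMid : Measurable fun p : ℕ × (ℕ → S) => (pointMeasure p, p) :=
    measurable_pointMeasure.prodMk measurable_id
  have hWlaw : (P.prod volume).map W = sampleLaw μ := by
    have := congrArg (Measure.map Prod.snd) hlaw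
    rw [Measure.map_map measurable_snd hNW,
      Measure.map_map measurable_snd hMid] at this
    exact this.trans Measure.map_id
  refine ⟨fun q => (W q).1, fun j q => (W q).2 j, ⟨hW.fst, fun j => ?_, ?_, fun n B hB => ?_⟩, ?_⟩
  · exact (measurable_pi_apply j).comp hW.snd
  · have := congrArg (Measure.map Prod.fst) hWlaw
    rw [Measure.map_map measurable_fst hW] at this
    refine this.trans ?_
    rw [sampleLaw]
    exact Measure.fst_prod
  · have hm1 : MeasurableSet {p : ℕ × (ℕ → S) | p.1 = n} :=
      measurable_fst (measurableSet_singleton n)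
    have hm2 : MeasurableSet {p : ℕ × (ℕ → S) | ∀ i : Fin n, p.2 i ∈ B i} := by
      simp only [ofPred_forall]
      exact MeasurableSet.iInter fun i =>
        ((measurable_pi_apply _).comp measurable_snd) (hB i)
    have h1 := sampleLaw_apply μ n B hB
    have h2 : sampleLaw μ {p | p.1 = n} = poissonMeasure (μ univ).toNNReal {n} := by
      have : ({p | p.1 = n} : Set (ℕ × (ℕ → S))) = {n} ×ˢ univ := by ext; simp
      rw [this, sampleLaw, Measure.prod_prod,
        measure_univ (μ := Measure.infinitePi fun _ => normalized μ), mul_one]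
    rw [← h2, ← hWlaw, Measure.map_apply hW hm1, Measure.map_apply hW (hm1.inter hm2)] at h1
    exact h1
  -- The law of `(N, W)` lives on the graph of `pointMeasure`; countably many evaluations make this
  -- a measurable almost sure statement.
  · obtain ⟨𝒜, hcount, hmeas, hext⟩ := exists_countable_ext (S := S)
    have hae : ∀ᵐ x ∂((P.prod volume).map fun q => (N q.1, W q)),
        ∀ s ∈ 𝒜, x.1 s = pointMeasure x.2 s := by
      rw [hlaw, ae_ball_iff hcount]
      intro s hs
      have hset : MeasurableSet {x : Measure S × (ℕ × (ℕ → S)) | x.1 s = pointMeasure x.2 s} :=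
        measurableSet_eq_fun ((Measure.measurable_coe (hmeas s hs)).comp measurable_fst)
          ((Measure.measurable_coe (hmeas s hs)).comp (measurable_pointMeasure.comp measurable_snd))
      rw [ae_map_iff hMid.aemeasurable hset]
      exact Eventually.of_forall fun p => rfl
    filter_upwards [ae_of_ae_map hNW.aemeasurable hae] with q hq
    exact hext _ (pointMeasure (W q)) inferInstance hq

end FiniteIntensity

/-! ### Truncation sets and symmetry. -/

section Truncation

variable {Ω : Type*}

/-- Markov's inequality. -/
lemma measure_lt_top_of_lintegral_min {S : Type*} [MeasurableSpace S] {ν : Measure S} {B C : Set S}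
    (hC : MeasurableSet C) (hCB : C ⊆ B) {f : S → ℝ≥0∞} {c : ℝ≥0∞} (hc : c ≠ 0)
    (hf : ∀ s ∈ C, c ≤ f s) (h : ∫⁻ s in B, f s ∂ν < ∞) : ν C < ∞ := by
  have h1 : c * ν C ≤ ∫⁻ s in B, f s ∂ν := by
    rw [← setLIntegral_const]
    exact (setLIntegral_mono' hC hf).trans (lintegral_mono_set hCB)
  exact lt_of_not_ge fun htop => absurd (h1.trans_lt h)
    (by simp [top_le_iff.1 htop, ENNReal.mul_top hc])

lemma lt_abs_of_mem_truncSet {K : ℝ → Set Ω} {ε : ℝ} {p : ℝ × Ω} (hp : p ∈ truncSet K ε) :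
    ε < |p.1| := by
  by_contra hcon
  exact hp.1 (abs_le.1 (not_lt.1 hcon))

lemma eventually_mem_truncSet {K : ℝ → Set Ω} (hKmono : ∀ ε δ, 0 < ε → ε ≤ δ → K δ ⊆ K ε)
    (hKU : ⋃ ε ∈ Ioi (0 : ℝ), K ε = univ) {u : ℕ → ℝ} (hu : ∀ n, 0 < u n)
    (hu0 : Tendsto u atTop (𝓝 0)) {p : ℝ × Ω} (hp : p.1 ≠ 0) :
    ∀ᶠ n in atTop, p ∈ truncSet K (u n) := by
  have hpK : p.2 ∈ ⋃ ε ∈ Ioi (0 : ℝ), K ε := by rw [hKU]; trivial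
  simp only [mem_iUnion, mem_Ioi, exists_prop] at hpK
  obtain ⟨δ, hδ, hpδ⟩ := hpK
  filter_upwards [hu0.eventually_lt_const hδ, hu0.eventually_lt_const (abs_pos.2 hp)] with n h1 h2
  exact ⟨fun hcon => absurd (abs_le.2 hcon) (not_le.2 h2), hKmono _ _ (hu n) h1.le hpδ⟩

variable [MeasurableSpace Ω]

lemma measurableSet_truncSet [TopologicalSpace Ω] [T2Space Ω] [OpensMeasurableSpace Ω]
    {K : ℝ → Set Ω} {ε : ℝ} (hK : IsCompact (K ε)) : MeasurableSet (truncSet K ε) :=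
  measurableSet_Icc.compl.prod hK.isClosed.measurableSet

lemma measure_truncSet_lt_top [TopologicalSpace Ω] [T2Space Ω] [OpensMeasurableSpace Ω]
    {ν : Measure (ℝ × Ω)} (hν : LocalL1 ν ∨ LocalL2 ν) {K : ℝ → Set Ω} {ε : ℝ} (hε : 0 < ε)
    (hK : IsCompact (K ε)) : ν (truncSet K ε) < ∞ := by
  have hsub : truncSet K ε ⊆ univ ×ˢ K ε := prod_mono (subset_univ _) subset_rfl
  have habs : ∀ p ∈ truncSet K ε, ENNReal.ofReal ε ≤ ‖p.1‖ₑ := fun p hp => by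
    rw [Real.enorm_eq_ofReal_abs]
    exact ENNReal.ofReal_le_ofReal (lt_abs_of_mem_truncSet hp).le
  have hε' : ENNReal.ofReal ε ≠ 0 := by simpa using hε
  rcases hν with hν | hν
  · exact measure_lt_top_of_lintegral_min (measurableSet_truncSet hK) hsub
      (c := min 1 (ENNReal.ofReal ε)) (by simp [hε])
      (fun p hp => min_le_min le_rfl (habs p hp)) (hν _ hK)
  · exact measure_lt_top_of_lintegral_min (measurableSet_truncSet hK) hsub
      (c := min 1 (ENNReal.ofReal ε ^ 2)) (by simp [hε])
      (fun p hp => min_le_min le_rfl (pow_le_pow_left' (habs p hp) 2)) (hν _ hK)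

/-- Reflection gives `∫ F = -∫ F`; integrability is not needed, since a divergent Bochner integral
is `0`. -/
lemma IsEven.integral_eq_zero {ν : Measure (ℝ × Ω)} (hν : IsEven ν) {F : ℝ × Ω → ℝ}
    (hF : Measurable F) (hodd : ∀ p : ℝ × Ω, F (-p.1, p.2) = -F p) : ∫ p, F p ∂ν = 0 := by
  have h := integral_map (μ := ν) (φ := fun p : ℝ × Ω => (-p.1, p.2)) (f := F)
    (by fun_prop) hF.aestronglyMeasurable
  rw [hν] at h
  simp only [hodd, integral_neg] at h
  linarith

lemma tendstoInMeasure_setIntegral_truncSet [TopologicalSpace Ω] [T2Space Ω]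
    [OpensMeasurableSpace Ω] {Θ : Type*} [MeasurableSpace Θ] {P : Measure Θ}
    [IsProbabilityMeasure P] {ν : Measure (ℝ × Ω)} (hν0 : ν ({0} ×ˢ univ) = 0)
    {N : Θ → Measure (ℝ × Ω)} (hN : IsPoissonRandomMeasure P ν N) {K : ℝ → Set Ω}
    (hKc : ∀ ε, 0 < ε → IsCompact (K ε)) (hKmono : ∀ ε δ, 0 < ε → ε ≤ δ → K δ ⊆ K ε)
    (hKU : ⋃ ε ∈ Ioi (0 : ℝ), K ε = univ) {h : ℝ → ℝ}
    (hcase : (LocalL1 ν ∧ h = 0) ∨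
      (LocalL2 ν ∧ IsEven ν ∧ IsCompensator h ∧ ∀ b, h (-b) = -h b))
    {φ : Ω → ℝ} (hφ : IsIntegrand ν h φ) :
    TendstoInMeasure P (fun ε θ => ∫ p in truncSet K ε, φ p.2 * p.1 ∂(N θ)) (𝓝[>] 0)
      (levyIntegral P ν N h φ) := by
  refine tendstoInMeasure_nhdsGT_of_seq fun u hu hu0 => ?_
  have hφm := hφ.measurable
  have hhm : Measurable h := by
    rcases hcase with ⟨-, rfl⟩ | ⟨-, -, hh, -⟩
    · exact measurable_zero
    · exact hh.measurable
  have hA : ∀ n, MeasurableSet (truncSet K (u n)) := fun n => measurableSet_truncSet (hKc _ (hu n))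
  have hlim : ∀ᵐ p ∂ν, ∀ᶠ n in atTop, p ∈ truncSet K (u n) := by
    filter_upwards [measure_eq_zero_iff_ae_notMem.1 hν0] with p hp
    exact eventually_mem_truncSet hKmono hKU hu hu0 fun h0 => hp (by simp [h0])
  have hHm : Measurable fun p : ℝ × Ω => h p.1 * φ p.2 := by fun_prop
  have hodd : h = 0 ∨ (IsEven ν ∧ ∀ b, h (-b) = -h b) := by
    rcases hcase with ⟨-, h0⟩ | ⟨-, he, -, ho⟩
    exacts [Or.inl h0, Or.inr ⟨he, ho⟩]
  have hsmall : ∀ n, ∫ p in truncSet K (u n),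
      {p : ℝ × Ω | |h p.1 * φ p.2| ≤ 1}.indicator (fun p => h p.1 * φ p.2) p ∂ν = 0 := by
    intro n
    rcases hodd with rfl | ⟨he, ho⟩
    · simp
    · rw [← integral_indicator (hA n)]
      refine he.integral_eq_zero
        ((hHm.indicator (measurableSet_le hHm.abs measurable_const)).indicator (hA n)) fun p => ?_
      -- Symmetry of `[-ε, ε]ᶜ` keeps the truncated integrand odd.
      have hmem : ((-p.1, p.2) : ℝ × Ω) ∈ truncSet K (u n) ↔ p ∈ truncSet K (u n) := by
        simp only [truncSet, mem_prod, mem_compl_iff, ← abs_le, mem_Icc, abs_neg]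
      simp only [indicator, mem_ofPred_eq, hmem, ho, neg_mul, abs_neg]
      split_ifs <;> simp_all
  have hlarge : ∫ p, {p : ℝ × Ω | 1 < |h p.1 * φ p.2|}.indicator (fun p => h p.1 * φ p.2) p ∂ν
      = 0 := by
    rcases hodd with rfl | ⟨he, ho⟩
    · simp
    · refine he.integral_eq_zero
        (hHm.indicator (measurableSet_lt measurable_const hHm.abs)) fun p => ?_
      simp only [indicator, mem_ofPred_eq, ho, neg_mul, abs_neg]
      split_ifs <;> simp
  have hfin : ∀ n, ν (truncSet K (u n)) < ∞ := fun n =>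
    measure_truncSet_lt_top (hcase.imp And.left And.left) (hu n) (hKc _ (hu n))
  have hsub : ∀ p : ℝ × Ω, φ p.2 * p.1 - h p.1 * φ p.2 = (p.1 - h p.1) * φ p.2 := fun p => by ring
  have hmain := hN.tendstoInMeasure_setIntegral hA hfin hlim (F := fun p => φ p.2 * p.1)
    (H := fun p => h p.1 * φ p.2) (by fun_prop) hHm
    (by simpa only [hsub] using hφ.poisson) hφ.compensated hsmall hlarge
  simpa only [hsub] using! hmain

end Truncation

end LevyField

end

/-! ### The theorem. -/

theorem corollary2 {Ω : Type*} [TopologicalSpace Ω] [PolishSpace Ω] [Nonempty Ω]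
    [MeasurableSpace Ω] [BorelSpace Ω] {X : Type*}
    {Θ : Type*} [MeasurableSpace Θ] (P : Measure Θ) [IsProbabilityMeasure P]
    (ν : Measure (ℝ × Ω)) (hν0 : ν ({0} ×ˢ univ) = 0)
    (N : Θ → Measure (ℝ × Ω)) (hN : LevyField.IsPoissonRandomMeasure P ν N)
    (K : ℝ → Set Ω) (hKc : ∀ ε, 0 < ε → IsCompact (K ε))
    (hKmono : ∀ ε δ, 0 < ε → ε ≤ δ → K δ ⊆ K ε) (hKU : ⋃ ε ∈ Ioi (0 : ℝ), K ε = univ)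
    (h : ℝ → ℝ)
    (hcase : (LevyField.LocalL1 ν ∧ h = 0) ∨
      (LevyField.LocalL2 ν ∧ LevyField.IsEven ν ∧ LevyField.IsCompensator h ∧
        ∀ b, h (-b) = -h b))
    (g : X → Ω → ℝ) (hg : ∀ x, LevyField.IsIntegrand ν h (g x)) :
    (∀ ε, 0 < ε → ν (LevyField.truncSet K ε) < ∞) ∧
    (∃ (J : ℝ → Θ × unitInterval → ℕ) (Z : ℝ → ℕ → Θ × unitInterval → ℝ × Ω),
      LevyField.IsTruncatedSample (P.prod volume) ν (fun q => N q.1) K J Z) ∧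
    ∀ (J : ℝ → Θ × unitInterval → ℕ) (Z : ℝ → ℕ → Θ × unitInterval → ℝ × Ω),
      LevyField.IsTruncatedSample (P.prod volume) ν (fun q => N q.1) K J Z →
      ∀ x, TendstoInMeasure (P.prod volume)
        (fun ε q => ∑ j ∈ Finset.range (J ε q), g x (Z ε j q).2 * (Z ε j q).1)
        (𝓝[>] 0) (fun q => LevyField.levyIntegral P ν N h (g x) q.1) := by
  have hfin : ∀ ε, 0 < ε → ν (LevyField.truncSet K ε) < ∞ := fun ε hε =>
    LevyField.measure_truncSet_lt_top (hcase.imp And.left And.left) hε (hKc ε hε)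
  refine ⟨hfin, ?_, fun J Z hJZ x => ?_⟩
  -- Lists for different `ε` are chosen separately from the same uniform variable; no consistency in
  -- `ε` is required.
  · have hex : ∀ ε : ℝ, ∃ (J : Θ × unitInterval → ℕ) (Z : ℕ → Θ × unitInterval → ℝ × Ω), 0 < ε →
        LevyField.IsPoissonSample (P.prod volume) (ν.restrict (LevyField.truncSet K ε)) J Z ∧
        ∀ᵐ q ∂(P.prod volume), (N q.1).restrict (LevyField.truncSet K ε)
          = ∑ j ∈ Finset.range (J q), Measure.dirac (Z j q) := by
      intro ε
      by_cases hε : 0 < ε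
      · have : IsFiniteMeasure (ν.restrict (LevyField.truncSet K ε)) := ⟨by simpa using hfin ε hε⟩
        obtain ⟨J, Z, hJZ⟩ :=
          (hN.restrict (LevyField.measurableSet_truncSet (hKc ε hε))).exists_isPoissonSample
        exact ⟨J, Z, fun _ => hJZ⟩
      · exact ⟨fun _ => 0, fun _ _ => Classical.arbitrary _, fun h => absurd h hε⟩
    choose J Z hJZ using hex
    exact ⟨J, Z, fun ε hε => (hJZ ε hε).1, fun ε hε => (hJZ ε hε).2⟩
  -- The sum depends on the list only through the restricted measure, so every listing gives the
  -- truncated integral almost surely.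
  · have hlim := LevyField.tendstoInMeasure_comp_fst (volume : Measure unitInterval)
      (LevyField.tendstoInMeasure_setIntegral_truncSet hν0 hN hKc hKmono hKU hcase (hg x))
    refine hlim.congr' ?_ ae_eq_rfl
    filter_upwards [self_mem_nhdsWithin] with ε hε
    have hgm := (hg x).measurable
    filter_upwards [hJZ.points ε hε] with q hq
    rw [hq]
    exact LevyField.integral_pointMeasure (J ε q, fun j => Z ε j q)
      (f := fun p : ℝ × Ω => g x p.2 * p.1) (by fun_prop)
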